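/- Let $0<\rho\in C^0([0,1];\mathbb R)$ and let $\mathcal H=L^2_\rho(0,1)$ be the real Hilbert space of square integrable functions on $(0,1)$ with inner product $\langle f,g\rangle=\int_0^1\rho(\xi)f(\xi)g(\xi)\,d\xi$. Let $\mathcal A:\mathcal D(\mathcal A)\subset\mathcal H\to\mathcal H$ be a self-adjoint operator with compact resolvent that generates a $C_0$-semigroup $(T(t))_{t\ge 0}$ on $\mathcal H$. Then there exist a non-increasing real sequence $(\lambda_n)_{n\ge1}$ with $\lambda_n\to-\infty$ and a Hilbert basis $(e_n)_{n\ge1}$ of $\mathcal H$ such that $e_n\in\mathcal D(\mathcal A)$ and $\mathcal A e_n=\lambda_n e_n$ for all $n$. Moreover, for every such choice of $(\lambda_n)$ and $(e_n)$, the following holds. Let $N\ge1$ be an integer with $\lambda_{N+1}<0$, let $D_0>0$, $\Lambda=\mathrm{diag}(\lambda_1,\dots,\lambda_N)$, and let $K\in\mathbb R^{N\times N}$, with rows $K_1,\dots,K_N$, be such that $A_{\mathrm{cl}}=\Lambda+e^{-D_0\Lambda}K$ is Hurwitz. Let $M\ge1$ and $\sigma>0$ be such that $\|e^{A_{\mathrm{cl}}t}\|\le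 Me^{-\sigma t}$ for all $t\ge0$, where vectors carry the Euclidean norm and matrices the induced norm. Let $\delta\in(0,D_0)$ satisfy $$\frac{\max(M,e^{\|A_{\mathrm{cl}}\|\delta})\sqrt N}{\sigma}\sum_{k=1}^N\|K_k\|\left\{(e^{\|A_{\mathrm{cl}}\|\delta}-1)+\sigma\delta e^{\sigma\delta}\right\}<1 .$$ Let $t_0>0$ and let $\varphi\in C^0(\mathbb R;\mathbb R)$ satisfy $0\le\varphi\le1$, $\varphi=0$ on $(-\infty,0]$ and $\varphi=1$ on $[t_0,\infty)$. Then there are constants $\kappa,C>0$ such that, for every $X_0\in\mathcal H$ and every continuous $D:[0,\infty)\times[0,1]\to\mathbb R$ with $|D-D_0|\le\delta$, the following closed-loop system has a unique solution, consisting of continuous functions $X:[0,\infty)\to\mathcal H$, $v:[0,\infty)\to\mathcal H$ and $w:\mathbb R\to\mathbb R^N$: - $X(t)=T(t)X_0+\int_0^tT(t-s)v(s)\,ds$ for all $t\ge0$ (that is, $X$ is the mild solution of $X'=\mathcal AX+v$, $X(0)=X_0$); - $[v(t)](\xi)=[u(t-D(t,\xi))](\xi)=\sum_{k=1}^Nw_k(t-D(t,\xi))e_k(\xi)$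 for all $t\ge0$ and almost all $\xi\in(0,1)$, where $u(t)=\sum_{k=1}^Nw_k(t)e_k$; - $w(t)=0$ for $t<0$ and, for all $t\ge0$, $$w(t)=\varphi(t)K\left\{x(t)+\int_{t-D_0}^te^{(t-D_0-s)\Lambda}w(s)\,ds\right\},\qquad x(t)=\big(\langle X(t),e_1\rangle,\dots,\langle X(t),e_N\rangle\big)^\top .$$ Moreover, this solution satisfies $\|X(t)\|_{\mathcal H}+\|u(t)\|_{\mathcal H}\le Ce^{-\kappa t}\|X_0\|_{\mathcal H}$ for all $t\ge0$. -/

import Mathlib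

open Set Filter Topology MeasureTheory

noncomputable section

/-! ### The weighted space of square integrable functions -/

/-- The measure `ρ(ξ) dξ` on the interval `(0, 1)`. -/
def weightedMeasure (ρ : ℝ → ℝ) : Measure ℝ :=
  (volume.restrict (Ioo (0 : ℝ) 1)).withDensity (fun ξ => ENNReal.ofReal (ρ ξ))

/-- The real Hilbert space `L²_ρ(0, 1)`, with inner product `∫₀¹ ρ(ξ) f(ξ) g(ξ) dξ`. -/
abbrev WeightedL2 (ρ : ℝ → ℝ) : Type := Lp ℝ 2 (weightedMeasure ρ)

/-! ### Unbounded operators and semigroups -/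

section Operators

variable {H : Type*} [NormedAddCommGroup H] [InnerProductSpace ℝ H]

/-- `R` is the resolvent `(μ - A)⁻¹` of `A` at the point `μ` of the resolvent set. -/
def IsResolventAt (A : H →ₗ.[ℝ] H) (μ : ℝ) (R : H →L[ℝ] H) : Prop :=
  (∀ y : H, ∃ hy : R y ∈ A.domain, μ • R y - A ⟨R y, hy⟩ = y) ∧
    ∀ x : A.domain, R (μ • (x : H) - A x) = (x : H)

/-- The resolvent set of `A` is not empty and `A` has a compact resolvent. -/
def HasCompactResolvent (A : H →ₗ.[ℝ] H) : Prop :=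
  ∃ (μ : ℝ) (R : H →L[ℝ] H), IsResolventAt A μ R ∧ IsCompactOperator R

/-- `(T(t))_{t ≥ 0}` is a strongly continuous semigroup of bounded operators (the values of `T` at
negative times are irrelevant). -/
structure IsC0Semigroup (T : ℝ → H →L[ℝ] H) : Prop where
  zero : T 0 = ContinuousLinearMap.id ℝ H
  add : ∀ s t : ℝ, 0 ≤ s → 0 ≤ t → T (s + t) = (T s).comp (T t)
  tendsto_zero : ∀ x : H, Tendsto (fun t : ℝ => T t x) (𝓝[>] 0) (𝓝 x)

/-- `A` is the generator of `T`: `x` lies in the domain of `A` and `A x = y` if and only if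
`(T(h) x - x) / h → y` as `h → 0⁺`. -/
def IsGeneratorOf (A : H →ₗ.[ℝ] H) (T : ℝ → H →L[ℝ] H) : Prop :=
  ∀ x y : H, (x, y) ∈ A.graph ↔
    Tendsto (fun h : ℝ => h⁻¹ • (T h x - x)) (𝓝[>] 0) (𝓝 y)

/-- `lam 0 ≥ lam 1 ≥ ⋯ → -∞` are the eigenvalues of `A`, repeated according to multiplicity, and
`e` is an associated Hilbert basis of eigenvectors. Indices start from `0`, so that `lam n` and
`e n` are the `(n + 1)`-st eigenvalue and eigenvector. -/
structure IsSortedEigenbasis (A : H →ₗ.[ℝ] H) (lam : ℕ → ℝ) (e : HilbertBasis ℕ ℝ H) : Prop where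
  antitone : Antitone lam
  tendsto_atBot : Tendsto lam atTop atBot
  mem_graph : ∀ n : ℕ, (e n, lam n • e n) ∈ A.graph

/-- `X` is the mild solution, on `[0, ∞)`, of `X' = A X + v`, `X(0) = X₀`, where `A` generates
`T` and `v` is continuous. -/
structure IsMildSolution (T : ℝ → H →L[ℝ] H) (X₀ : H) (v X : ℝ → H) : Prop where
  continuousOn_input : ContinuousOn v (Ici 0)
  continuousOn : ContinuousOn X (Ici 0)
  eq : ∀ t : ℝ, 0 ≤ t → X t = T t X₀ + ∫ s in (0 : ℝ)..t, T (t - s) (v s)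

/-- The vector of the first `N` coordinates of `x` in the Hilbert basis `e`. -/
def modes (e : HilbertBasis ℕ ℝ H) (N : ℕ) (x : H) : EuclideanSpace ℝ (Fin N) :=
  WithLp.toLp 2 (fun k : Fin N => inner ℝ x (e k))

/-- The element `∑_{k ≤ N} w_k e_k`. -/
def synthesis (e : HilbertBasis ℕ ℝ H) {N : ℕ} (w : EuclideanSpace ℝ (Fin N)) : H :=
  ∑ k : Fin N, w k • e k

end Operators

/-! ### Matrices -/

/-- The diagonal matrix of the first `N` terms of `lam`. -/
def diagMatrix (lam : ℕ → ℝ) (N : ℕ) : Matrix (Fin N) (Fin N) ℝ :=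
  Matrix.diagonal (fun k : Fin N => lam k)

/-- The closed-loop matrix `Λ + e^{-D₀ Λ} K`. -/
def closedLoopMatrix (lam : ℕ → ℝ) {N : ℕ} (D₀ : ℝ) (K : Matrix (Fin N) (Fin N) ℝ) :
    Matrix (Fin N) (Fin N) ℝ :=
  diagMatrix lam N + NormedSpace.exp ((-D₀) • diagMatrix lam N) * K

/-- The norm of a matrix that is induced by the Euclidean norm. -/
def matNorm {N : ℕ} (B : Matrix (Fin N) (Fin N) ℝ) : ℝ :=
  ‖Matrix.toEuclideanCLM (𝕜 := ℝ) B‖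

/-- The Euclidean norm of the `k`-th row of a matrix. -/
def rowNorm {N : ℕ} (B : Matrix (Fin N) (Fin N) ℝ) (k : Fin N) : ℝ :=
  ‖(WithLp.toLp 2 (B k) : EuclideanSpace ℝ (Fin N))‖

/-- All complex eigenvalues of the real matrix `B` have a negative real part. -/
def IsHurwitz {N : ℕ} (B : Matrix (Fin N) (Fin N) ℝ) : Prop :=
  ∀ z ∈ spectrum ℂ (B.map (algebraMap ℝ ℂ)), z.re < 0

/-! ### The control law and the closed loop -/

/-- `φ` is a transition signal over `[0, t₀]`. -/
structure IsTransitionSignal (φ : ℝ → ℝ) (t₀ : ℝ) : Prop where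
  continuous : Continuous φ
  mem_Icc : ∀ t, φ t ∈ Icc (0 : ℝ) 1
  eq_zero : ∀ t ≤ 0, φ t = 0
  eq_one : ∀ t, t₀ ≤ t → φ t = 1

/-- `D` is a continuous delay on `[0, ∞) × [0, 1]` with `|D - D₀| ≤ δ`. -/
structure IsAdmissibleDelay (D₀ δ : ℝ) (D : ℝ → ℝ → ℝ) : Prop where
  continuousOn : ContinuousOn (fun p : ℝ × ℝ => D p.1 p.2) (Ici (0 : ℝ) ×ˢ Icc (0 : ℝ) 1)
  abs_sub_le : ∀ t ξ : ℝ, 0 ≤ t → ξ ∈ Icc (0 : ℝ) 1 → |D t ξ - D₀| ≤ δ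

/-- The constant-delay predictor feedback
`w(t) = φ(t) K { x(t) + ∫_{t-D₀}^t e^{(t-D₀-s) Λ} w(s) ds }` for `t ≥ 0`, and `w(t) = 0` for
`t < 0`, where `x(t)` is the vector of the first `N` coordinates of `X(t)`. -/
structure IsPredictorFeedback {H : Type*} [NormedAddCommGroup H] [InnerProductSpace ℝ H]
    (lam : ℕ → ℝ) (e : HilbertBasis ℕ ℝ H) {N : ℕ} (D₀ : ℝ) (K : Matrix (Fin N) (Fin N) ℝ)
    (φ : ℝ → ℝ) (X : ℝ → H) (w : ℝ → EuclideanSpace ℝ (Fin N)) : Prop where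
  continuous : Continuous w
  eq_zero : ∀ t < 0, w t = 0
  eq : ∀ t, 0 ≤ t → w t = φ t • Matrix.toEuclideanCLM (𝕜 := ℝ) K
    (modes e N (X t) + ∫ s in (t - D₀)..t,
      Matrix.toEuclideanCLM (𝕜 := ℝ) (NormedSpace.exp ((t - D₀ - s) • diagMatrix lam N)) (w s))

/-- The closed loop with state `X`, control input `u(t) = ∑_{k ≤ N} w_k(t) e_k` and delayed input
`v(t)`, where `[v(t)](ξ) = [u(t - D(t, ξ))](ξ) = ∑_{k ≤ N} w_k(t - D(t, ξ)) e_k(ξ)`. -/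
structure IsClosedLoopSolution {ρ : ℝ → ℝ} (T : ℝ → WeightedL2 ρ →L[ℝ] WeightedL2 ρ)
    (lam : ℕ → ℝ) (e : HilbertBasis ℕ ℝ (WeightedL2 ρ)) {N : ℕ} (D₀ : ℝ)
    (K : Matrix (Fin N) (Fin N) ℝ) (φ : ℝ → ℝ) (D : ℝ → ℝ → ℝ) (X₀ : WeightedL2 ρ)
    (X v : ℝ → WeightedL2 ρ) (w : ℝ → EuclideanSpace ℝ (Fin N)) : Prop where
  feedback : IsPredictorFeedback lam e D₀ K φ X w
  input : ∀ t, 0 ≤ t → v t =ᵐ[weightedMeasure ρ] fun ξ => ∑ k : Fin N, w (t - D t ξ) k * e k ξ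
  mild : IsMildSolution T X₀ v X

end

/-! A resolvent of `A` is compact and symmetric, so it has a Hilbert basis of eigenvectors, and
these are eigenvectors of `A`. The semigroup bounds the eigenvalues of `A` from above and
compactness leaves only finitely many above any level, so they can be sorted
(`exists_isSortedEigenbasis`). Since `T t` acts on `e n` by `e^{λ_n t}`, the state splits into
finitely many modes, which obey a finite-dimensional equation, and a tail, which decays because the
first discarded eigenvalue is negative.

The closed loop reduces to one equation for `w`. The modes plus the history integral (the Artstein
transform) give `predictorState`, a function `z` of the initial modes and of `w` alone, and the
feedback reads `w = φ K z`. In the norm `sup e^{-γt}‖w(t)‖` with `γ` large the right side is a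
contraction. This gives existence, uniqueness and a growth bound that does not depend on the delay
(`IsDelayedInput.exists_fixedPoint`, `IsDelayedInput.fixedPoint_unique`); the state then comes from
the mild formula.

For the decay, once `φ = 1` one has `z' = A_cl z + Δ`, where `Δ` is the difference between the modes
of the delayed input and `w(t - D₀)`. A constant signal is not affected by delays, so `Δ(t)` is at
most `∑ ‖K_k‖` times the oscillation of `z` about `z(t - D₀)` over `[t - D₀ - δ, t - D₀ + δ]`.
Variation of constants bounds that oscillation by past values of `z` and `Δ`. The loop closes with
the factor `loopGain`, which is below 1 at rate `κ = 0` by the condition on `δ`, hence also for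
small `κ > 0` (`exists_norm_le_of_loopGain_lt_one`). The decay of `z` passes to `w`, to the history
integral and so to the modes, and through the input to the tail (`exists_norm_add_norm_le`). -/

/-! ### Enumeration of a family with finite superlevel sets -/

/-- An infinite family of reals whose superlevel sets are finite has a non-increasing enumeration. -/
theorem exists_equiv_nat_antitone {ι : Type*} [Infinite ι] (f : ι → ℝ)
    (hf : ∀ c : ℝ, {i | c ≤ f i}.Finite) : ∃ g : ℕ ≃ ι, Antitone (f ∘ g) := by
  have hcount : Countable ι := by
    rw [← Set.countable_univ_iff]
    have : (univ : Set ι) = ⋃ n : ℕ, {i | -(n : ℝ) ≤ f i} := by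
      ext i
      obtain ⟨n, hn⟩ := exists_nat_ge (-f i)
      simp only [mem_univ, mem_iUnion, mem_ofPred_eq, true_iff]
      exact ⟨n, by linarith⟩
    rw [this]
    exact countable_iUnion fun n => (hf _).countable
  obtain ⟨enc, henc⟩ := exists_injective_nat ι
  -- Decreasing values of `f`, with ties broken by `enc`. Initial segments then lie in superlevel
  -- sets, so they are finite, and the rank of `i` is the size of the segment below it.
  let _ : LinearOrder ι := LinearOrder.lift' (fun i => toLex (-(f i), enc i)) (by
    intro i j hij
    have := congrArg (fun p => (ofLex p).2) hij
    exact henc this)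
  have hlt : ∀ {i j : ι}, i < j → f j ≤ f i := by
    intro i j hij
    have : toLex (-(f i), enc i) < toLex (-(f j), enc j) := hij
    rw [Prod.Lex.lt_iff] at this
    rcases this with h | h
    · have : -(f i) < -(f j) := h
      linarith
    · have : -(f i) = -(f j) := h.1
      linarith
  have hfin : ∀ i : ι, (Iio i).Finite := fun i => (hf (f i)).subset fun j hj => hlt hj
  have hmono : StrictMono fun i : ι => (Iio i).ncard := by
    intro i j hij
    apply Set.ncard_lt_ncard _ (hfin j)
    rw [Set.ssubset_iff_of_subset (Iio_subset_Iio hij.le)]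
    exact ⟨i, hij, lt_irrefl i⟩
  have hsurj : Function.Surjective fun i : ι => (Iio i).ncard := by
    intro n
    have hinf : (range fun i : ι => (Iio i).ncard).Infinite :=
      infinite_range_of_injective hmono.injective
    obtain ⟨m₀, hm₀, hnm₀⟩ := hinf.exists_gt n
    classical
    have hex : ∃ m, n ≤ m ∧ m ∈ range fun i : ι => (Iio i).ncard := ⟨m₀, hnm₀.le, hm₀⟩
    -- The least attained rank that is at least `n` equals `n`: if it exceeded `n`, all elements
    -- below `i` would have ranks below `n`, so there would be at most `n` of them.
    obtain ⟨hn, i, hi⟩ := Nat.find_spec hex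
    refine ⟨i, ?_⟩
    by_contra hne
    have hgt : n < (Iio i).ncard := lt_of_le_of_ne (hn.trans hi.ge) (Ne.symm hne)
    have hmaps : ∀ j ∈ Iio i, (Iio j).ncard ∈ (Finset.range n : Set ℕ) := by
      intro j hj
      have h1 : (Iio j).ncard < Nat.find hex := by rw [← hi]; exact hmono hj
      have h2 := Nat.find_min hex h1
      simp only [not_and, mem_range, not_exists] at h2
      simp only [Finset.coe_range, mem_Iio]
      by_contra h3
      exact h2 (not_lt.mp h3) j rfl
    have := Set.ncard_le_ncard_of_injOn _ hmaps hmono.injective.injOn (Finset.finite_toSet _)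
    rw [Set.ncard_coe_finset, Finset.card_range] at this
    omega
  let g := Equiv.ofBijective _ ⟨hmono.injective, hsurj⟩
  refine ⟨g.symm, ?_⟩
  intro m n hmn
  rcases hmn.eq_or_lt with rfl | h
  · exact le_rfl
  · apply hlt
    rw [← hmono.lt_iff_lt]
    have e1 : (Iio (g.symm m)).ncard = m := g.apply_symm_apply m
    have e2 : (Iio (g.symm n)).ncard = n := g.apply_symm_apply n
    simp only [e1, e2, h]

/-! ### Eigenvectors of compact symmetric operators -/

section Compact

universe u
variable {H : Type u} [NormedAddCommGroup H] [InnerProductSpace ℝ H]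

/-- The eigenvalues of a compact operator along an orthonormal family of eigenvectors accumulate
only at zero. -/
theorem IsCompactOperator.finite_setOf_le_abs_eigenvalue {R : H →L[ℝ] H}
    (hR : IsCompactOperator R) {ι : Type*} {v : ι → H} (hv : Orthonormal ℝ v) {ν : ι → ℝ}
    (hν : ∀ i, R (v i) = ν i • v i) {c : ℝ} (hc : 0 < c) : {i | c ≤ |ν i|}.Finite := by
  by_contra hinf
  let f := Set.Infinite.natEmbedding _ hinf
  -- By orthogonality, `‖R v_i - R v_j‖² = ν_i² + ν_j² ≥ c²` for distinct indices in the set, so the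
  -- images of infinitely many such vectors have no Cauchy subsequence.
  have hK := IsCompactOperator.isCompact_closure_image_closedBall (f := (R : H →ₗ[ℝ] H)) hR 1
  obtain ⟨a, -, ψ, hψ, hlim⟩ := hK.tendsto_subseq (x := fun n => R (v (f n))) (by
    intro n
    apply subset_closure
    refine ⟨v (f n), ?_, rfl⟩
    simp [hv.1])
  have hcau := hlim.cauchySeq
  rw [Metric.cauchySeq_iff'] at hcau
  obtain ⟨n, hn⟩ := hcau c hc
  have h := hn (n + 1) (Nat.le_succ n)
  have hne : (f (ψ (n + 1)) : ι) ≠ f (ψ n) := by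
    intro h'
    have := hψ.injective (f.injective (Subtype.ext h'))
    omega
  have h0 : inner ℝ (v (f (ψ (n + 1)))) (v (f (ψ n))) = 0 := hv.2 hne
  have hsq : ‖R (v (f (ψ (n + 1)))) - R (v (f (ψ n)))‖ ^ 2
      = ν (f (ψ (n + 1))) ^ 2 + ν (f (ψ n)) ^ 2 := by
    rw [hν, hν, @norm_sub_sq_real]
    simp [inner_smul_left, inner_smul_right, h0, norm_smul, hv.1]
  have hle : c ≤ |ν (f (ψ (n + 1)))| := (f (ψ (n + 1))).2
  simp only [Function.comp, dist_eq_norm] at h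
  have h1 : c ^ 2 ≤ ν (f (ψ (n + 1))) ^ 2 := by
    rw [← sq_abs (ν _)]; gcongr
  have h2 := pow_lt_pow_left₀ h (norm_nonneg _) two_ne_zero
  nlinarith [sq_nonneg (ν (f (ψ n)))]

/-- A compact symmetric operator has a Hilbert basis of eigenvectors. -/
theorem IsCompactOperator.exists_hilbertBasis_eigenvectors [CompleteSpace H] {R : H →L[ℝ] H}
    (hR : IsCompactOperator R) (hsymm : (R : H →ₗ[ℝ] H).IsSymmetric) :
    ∃ (ι : Type u) (b : HilbertBasis ι ℝ H) (ν : ι → ℝ), ∀ i, R (b i) = ν i • b i := by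
  have horth := hsymm.orthogonalFamily_eigenspaces
  have hbot := ContinuousLinearMap.orthogonalComplement_iSup_eigenspaces_eq_bot hR hsymm
  let E : ℝ → Submodule ℝ H := fun μ => Module.End.eigenspace (R : H →ₗ[ℝ] H) μ
  have hclosed : ∀ μ, IsClosed (E μ : Set H) := by
    intro μ
    have : (E μ : Set H) = {x | R x = μ • x} := by
      ext x
      simp [E]
    rw [this]
    exact isClosed_eq R.continuous (continuous_const_smul μ)
  have hcomplete : ∀ μ, CompleteSpace (E μ) := fun μ => (hclosed μ).completeSpace_coe
  choose w b hb using fun μ => exists_hilbertBasis ℝ (E μ)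
  have hon : Orthonormal ℝ fun a : Σ μ, w μ => ((a.2 : E a.1) : H) :=
    horth.orthonormal_sigma_orthonormal (v_family := fun μ (x : w μ) => (x : E μ)) (fun μ => by
      rw [← hb μ]; exact (b μ).orthonormal)
  -- The basis is the union of Hilbert bases of the eigenspaces. A vector orthogonal to all of them
  -- is orthogonal to each eigenspace, by expansion there, hence zero by the spectral theorem.
  refine ⟨Σ μ, w μ, HilbertBasis.mkOfOrthogonalEqBot hon ?_, fun a => a.1, ?_⟩
  · rw [eq_bot_iff, ← hbot]
    intro x hx
    rw [Submodule.mem_orthogonal] at hx ⊢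
    intro u hu
    have hle : (⨆ μ, E μ) ≤ (ℝ ∙ x)ᗮ := by
      refine iSup_le fun μ y hy => ?_
      rw [Submodule.mem_orthogonal_singleton_iff_inner_left]
      have hs := ((b μ).hasSum_repr ⟨y, hy⟩)
      have hs2 : HasSum (fun i => inner ℝ x (((b μ).repr ⟨y, hy⟩ i • b μ i : E μ) : H))
          (inner ℝ x y) := ((innerSL ℝ x).comp (E μ).subtypeL).hasSum hs
      rw [real_inner_comm]
      refine hs2.unique ?_
      convert! hasSum_zero using 2 with i
      have := hx (b μ i) (Submodule.subset_span ⟨⟨μ, i⟩, by simp [hb μ]⟩)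
      rw [real_inner_comm] at this
      simp [inner_smul_right, this]
    exact (Submodule.mem_orthogonal_singleton_iff_inner_left.mp (hle hu))
  · intro a
    rw [HilbertBasis.coe_mkOfOrthogonalEqBot]
    exact Module.End.mem_eigenspace_iff.mp (a.2 : E a.1).2

end Compact

/-! ### Strongly continuous semigroups -/

section Semigroup

variable {H : Type*} [NormedAddCommGroup H] [InnerProductSpace ℝ H] {T : ℝ → H →L[ℝ] H}

/-- The absolute value turns the one-sided limit into a limit along the full neighbourhood filter,
which composes with any real function tending to 0. -/
theorem IsC0Semigroup.tendsto_abs (hT : IsC0Semigroup T) (x : H) :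
    Tendsto (fun t : ℝ => T |t| x) (𝓝 0) (𝓝 x) := by
  have h1 : ContinuousWithinAt (fun t => T t x) (Ioi 0) 0 := by
    simpa [ContinuousWithinAt, hT.zero] using! hT.tendsto_zero x
  have h2 : Tendsto (fun t => T t x) (𝓝[≥] 0) (𝓝 x) := by
    simpa [ContinuousWithinAt, hT.zero] using! continuousWithinAt_Ioi_iff_Ici.mp h1
  refine h2.comp (tendsto_nhdsWithin_iff.mpr ⟨?_, Eventually.of_forall fun t => abs_nonneg t⟩)
  simpa using continuous_abs.tendsto (0 : ℝ)

theorem IsC0Semigroup.norm_sub_le (hT : IsC0Semigroup T) {a C : ℝ}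
    (hC : ∀ t ∈ Icc 0 a, ‖T t‖ ≤ C) (x : H) {s t : ℝ} (hs : s ∈ Icc 0 a) (ht : t ∈ Icc 0 a) :
    ‖T t x - T s x‖ ≤ C * ‖T |t - s| x - x‖ := by
  wlog hst : s ≤ t generalizing s t
  · rw [norm_sub_rev, abs_sub_comm]
    exact this ht hs (le_of_not_ge hst)
  have h : T t = (T s).comp (T |t - s|) := by
    rw [← hT.add _ _ hs.1 (abs_nonneg _), abs_of_nonneg (by linarith)]; congr 1; ring
  rw [h, ContinuousLinearMap.comp_apply, ← map_sub]
  exact (T s).le_of_opNorm_le (hC s hs) _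

variable [CompleteSpace H]

/-- Uniform boundedness principle: otherwise the norms `‖T (t n)‖` are unbounded along some `t n →
0`, although each orbit `T (t n) x` converges. -/
theorem IsC0Semigroup.exists_norm_le_near_zero (hT : IsC0Semigroup T) :
    ∃ r > 0, ∃ C : ℝ, ∀ t ∈ Icc 0 r, ‖T t‖ ≤ C := by
  by_contra! hcon
  choose t ht hn using fun n : ℕ => hcon (1 / ((n : ℝ) + 1)) (by positivity) n
  have hlim : Tendsto t atTop (𝓝 0) :=
    squeeze_zero (fun n => (ht n).1) (fun n => (ht n).2) tendsto_one_div_add_atTop_nhds_zero_nat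
  obtain ⟨C, hC⟩ := banach_steinhaus (g := fun n => T (t n)) (by
    intro x
    have h := ((hT.tendsto_abs x).comp hlim).norm.bddAbove_range
    obtain ⟨C, hC⟩ := h
    refine ⟨C, fun n => ?_⟩
    have := hC ⟨n, rfl⟩
    simpa [abs_of_nonneg (ht n).1] using this)
  obtain ⟨n, hn'⟩ := exists_nat_gt C
  exact absurd (hC n) (not_le.mpr (hn'.trans (hn n)))

theorem IsC0Semigroup.exists_norm_le (hT : IsC0Semigroup T) (a : ℝ) :
    ∃ C : ℝ, ∀ t ∈ Icc 0 a, ‖T t‖ ≤ C := by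
  obtain ⟨r, hr, C, hC⟩ := hT.exists_norm_le_near_zero
  have key : ∀ n : ℕ, ∀ t ∈ Icc 0 (n * r), ‖T t‖ ≤ max 1 C ^ (n + 1) := by
    intro n
    induction n with
    | zero =>
      intro t ht
      have := hC t ⟨ht.1, ht.2.trans (by simpa using hr.le)⟩
      simpa using Or.inr this
    | succ n ih =>
      intro t ht
      have h1 : 1 ≤ max 1 C := le_max_left _ _
      rcases le_total t r with h | h
      · refine (hC t ⟨ht.1, h⟩).trans ((le_max_right 1 C).trans ?_)
        exact le_self_pow₀ h1 (by omega)
      · have h2 : T t = (T r).comp (T (t - r)) := by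
          rw [← hT.add r (t - r) hr.le (by linarith)]; congr 1; ring
        rw [h2, pow_succ']
        refine (ContinuousLinearMap.opNorm_comp_le _ _).trans ?_
        have h3 := ih (t - r) ⟨by linarith, by
          have := ht.2; push_cast at this; linarith⟩
        have h4 := (hC r ⟨hr.le, le_rfl⟩).trans (le_max_right 1 C)
        gcongr
  obtain ⟨n, hn⟩ := exists_nat_ge (a / r)
  refine ⟨max 1 C ^ (n + 1), fun t ht => key n t ⟨ht.1, ht.2.trans ?_⟩⟩
  rwa [div_le_iff₀ hr] at hn

theorem IsC0Semigroup.continuousOn (hT : IsC0Semigroup T) (x : H) :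
    ContinuousOn (fun t => T t x) (Ici 0) := by
  intro t₀ ht₀
  obtain ⟨C, hC⟩ := hT.exists_norm_le (t₀ + 1)
  have ht₀' : (0 : ℝ) ≤ t₀ := ht₀
  rw [ContinuousWithinAt, tendsto_iff_norm_sub_tendsto_zero]
  have h1 : Tendsto (fun t : ℝ => C * ‖T |t - t₀| x - x‖) (𝓝[Ici 0] t₀) (𝓝 0) := by
    have h2 : Tendsto (fun t : ℝ => t - t₀) (𝓝[Ici 0] t₀) (𝓝 0) := by
      have : Tendsto (fun t : ℝ => t - t₀) (𝓝 t₀) (𝓝 (t₀ - t₀)) :=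
        (continuous_id.sub continuous_const).tendsto t₀
      rw [sub_self] at this
      exact this.mono_left nhdsWithin_le_nhds
    have h3 := (((hT.tendsto_abs x).comp h2).sub_const x).norm.const_mul C
    simpa using h3
  refine squeeze_zero' (Eventually.of_forall fun t => norm_nonneg _) ?_ h1
  filter_upwards [self_mem_nhdsWithin, mem_nhdsWithin_of_mem_nhds (Iio_mem_nhds (lt_add_one t₀))]
    with t ht ht'
  exact hT.norm_sub_le hC x ⟨ht₀', by linarith⟩ ⟨ht, le_of_lt ht'⟩

/-- A semigroup acts on an eigenvector of its generator by the exponential of the eigenvalue. -/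
theorem IsC0Semigroup.apply_eigenvector (hT : IsC0Semigroup T) {A : H →ₗ.[ℝ] H}
    (hAT : IsGeneratorOf A T) {x : H} {μ : ℝ} (hx : (x, μ • x) ∈ A.graph) {t : ℝ} (ht : 0 ≤ t) :
    T t x = Real.exp (μ * t) • x := by
  have hlim := (hAT x (μ • x)).mp hx
  -- The generator only gives right derivatives. These suffice, because a continuous function with
  -- zero right derivative is constant; it is applied to `e^{-μt} T t x`.
  have hderiv : ∀ s : ℝ, 0 ≤ s → HasDerivWithinAt (fun t => T t x) (μ • T s x) (Ici s) s := by
    intro s hs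
    rw [← hasDerivWithinAt_Ioi_iff_Ici, hasDerivWithinAt_iff_tendsto_slope' (by simp)]
    have h1 := ((T s).continuous.tendsto _).comp hlim
    rw [map_smul] at h1
    have h2 : Tendsto (fun r : ℝ => r - s) (𝓝[>] s) (𝓝[>] 0) := by
      refine tendsto_nhdsWithin_iff.mpr ⟨?_, ?_⟩
      · have : Tendsto (fun t : ℝ => t - s) (𝓝 s) (𝓝 (s - s)) :=
          (continuous_id.sub continuous_const).tendsto s
        rw [sub_self] at this
        exact this.mono_left nhdsWithin_le_nhds
      · filter_upwards [self_mem_nhdsWithin] with r hr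
        exact sub_pos.mpr (mem_Ioi.mp hr)
    refine (h1.comp h2).congr' ?_
    filter_upwards [self_mem_nhdsWithin] with r hr
    have hr' : s < r := hr
    have h3 : T r = (T s).comp (T (r - s)) := by
      rw [← hT.add s (r - s) hs (by linarith)]; congr 1; ring
    simp [slope, h3]
  have hd2 : ∀ s ∈ Ico 0 t, HasDerivWithinAt (fun t => Real.exp (-(μ * t)) • T t x) 0 (Ici s) s := by
    intro s hs
    have h1 : HasDerivAt (fun t : ℝ => Real.exp (-(μ * t))) (Real.exp (-(μ * s)) * (-(μ * 1))) s :=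
      (((hasDerivAt_id s).const_mul μ).neg).exp
    convert! (h1.hasDerivWithinAt (s := Ici s)).smul (hderiv s hs.1) using 1
    module
  have hcont : ContinuousOn (fun t => Real.exp (-(μ * t)) • T t x) (Icc 0 t) :=
    ContinuousOn.smul (by fun_prop) ((hT.continuousOn x).mono Icc_subset_Ici_self)
  have h := constant_of_has_deriv_right_zero hcont hd2 t ⟨ht, le_rfl⟩
  simp only [mul_zero, neg_zero, Real.exp_zero, one_smul, hT.zero,
    ContinuousLinearMap.id_apply] at h
  calc T t x = Real.exp (μ * t) • (Real.exp (-(μ * t)) • T t x) := by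
        rw [smul_smul, ← Real.exp_add]
        simp
    _ = Real.exp (μ * t) • x := by rw [h]

/-- Joint continuity of a strongly continuous semigroup. -/
theorem IsC0Semigroup.continuous_uncurry (hT : IsC0Semigroup T) :
    Continuous fun p : ℝ × H => T (max p.1 0) p.2 := by
  rw [continuous_iff_continuousAt]
  rintro ⟨t₀, x₀⟩
  obtain ⟨C, hC⟩ := hT.exists_norm_le (max t₀ 0 + 1)
  have hcont : Continuous fun t : ℝ => T (max t 0) x₀ :=
    (hT.continuousOn x₀).comp_continuous (by fun_prop) fun t => le_max_right t 0
  rw [ContinuousAt, tendsto_iff_norm_sub_tendsto_zero]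
  have h1 : Tendsto (fun p : ℝ × H => C * ‖p.2 - x₀‖ + ‖T (max p.1 0) x₀ - T (max t₀ 0) x₀‖)
      (𝓝 (t₀, x₀)) (𝓝 0) := by
    have : Continuous fun p : ℝ × H =>
        C * ‖p.2 - x₀‖ + ‖T (max p.1 0) x₀ - T (max t₀ 0) x₀‖ := by
      have h := hcont.comp (continuous_fst (X := ℝ) (Y := H))
      exact (continuous_const.mul (continuous_snd.sub continuous_const).norm).add
        (h.sub continuous_const).norm
    simpa using this.tendsto (t₀, x₀)
  refine squeeze_zero' (Eventually.of_forall fun t => norm_nonneg _) ?_ h1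
  have hnear : ∀ᶠ p : ℝ × H in 𝓝 (t₀, x₀), max p.1 0 < max t₀ 0 + 1 := by
    have : Continuous fun p : ℝ × H => max p.1 0 := by fun_prop
    exact this.tendsto (t₀, x₀) (Iio_mem_nhds (lt_add_one _))
  filter_upwards [hnear] with p hp
  -- The first term is controlled by the local bound on `‖T‖`, the second by strong continuity at
  -- the fixed vector `x₀`.
  have h2 : T (max p.1 0) p.2 - T (max t₀ 0) x₀
      = T (max p.1 0) (p.2 - x₀) + (T (max p.1 0) x₀ - T (max t₀ 0) x₀) := by
    rw [map_sub]; abel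
  rw [h2]
  refine (norm_add_le _ _).trans (add_le_add_left ?_ _)
  exact (T (max p.1 0)).le_of_opNorm_le (hC _ ⟨le_max_right _ _, hp.le⟩) _

end Semigroup

/-! ### Eigenbasis of a self-adjoint generator with compact resolvent -/

section Eigenbasis

variable {H : Type*} [NormedAddCommGroup H] [InnerProductSpace ℝ H]

/-- An eigenvector of the resolvent at `μ` with eigenvalue `ν` is an eigenvector of the operator
with eigenvalue `μ - ν⁻¹`. -/
theorem IsResolventAt.mem_graph {A : H →ₗ.[ℝ] H} {μ : ℝ} {R : H →L[ℝ] H}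
    (hR : IsResolventAt A μ R) {x : H} (hx : x ≠ 0) {ν : ℝ} (h : R x = ν • x) :
    ν ≠ 0 ∧ (x, (μ - ν⁻¹) • x) ∈ A.graph := by
  obtain ⟨hd, he⟩ := hR.1 x
  have hν : ν ≠ 0 := by
    rintro rfl
    have h0 : (⟨R x, hd⟩ : A.domain) = 0 := Subtype.ext (by simp [h])
    rw [h0] at he
    simp [h] at he
    exact hx he.symm
  refine ⟨hν, ?_⟩
  have hg : (R x, A ⟨R x, hd⟩) ∈ A.graph := A.mem_graph ⟨R x, hd⟩
  have := A.graph.smul_mem ν⁻¹ hg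
  convert! this using 1
  rw [eq_sub_iff_add_eq'.mpr (sub_eq_iff_eq_add.mp he).symm, h]
  simp only [Prod.smul_mk, Prod.mk.injEq]
  constructor
  · rw [smul_smul, inv_mul_cancel₀ hν, one_smul]
  · rw [smul_sub, smul_smul, smul_smul, sub_smul]
    congr 2
    field_simp

variable [CompleteSpace H]

theorem IsSelfAdjoint.inner_linearPMap {A : H →ₗ.[ℝ] H} (hA : IsSelfAdjoint A)
    (x y : A.domain) : inner ℝ (A x) (y : H) = inner ℝ (x : H) (A y) := by
  have h := LinearPMap.adjoint_isFormalAdjoint hA.dense_domain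
  rw [LinearPMap.isSelfAdjoint_def.mp hA] at h
  exact h x y

theorem IsResolventAt.isSymmetric {A : H →ₗ.[ℝ] H} (hA : IsSelfAdjoint A) {μ : ℝ} {R : H →L[ℝ] H}
    (hR : IsResolventAt A μ R) : (R : H →ₗ[ℝ] H).IsSymmetric := by
  intro x y
  obtain ⟨hx, ex⟩ := hR.1 x
  obtain ⟨hy, ey⟩ := hR.1 y
  have h := hA.inner_linearPMap ⟨R x, hx⟩ ⟨R y, hy⟩
  simp only at h
  change inner ℝ (R x) y = inner ℝ x (R y)
  conv_lhs => rw [← ey]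
  conv_rhs => rw [← ex]
  rw [inner_sub_left, inner_sub_right, inner_smul_left, inner_smul_right, h]
  simp

theorem exists_isSortedEigenbasis (hH : ¬ FiniteDimensional ℝ H) {A : H →ₗ.[ℝ] H}
    (hA : IsSelfAdjoint A) (hA_res : HasCompactResolvent A) {T : ℝ → H →L[ℝ] H}
    (hT : IsC0Semigroup T) (hAT : IsGeneratorOf A T) :
    ∃ (lam : ℕ → ℝ) (e : HilbertBasis ℕ ℝ H), IsSortedEigenbasis A lam e := by
  obtain ⟨μ, R, hR, hRc⟩ := hA_res
  obtain ⟨ι, b, ν, hν⟩ := hRc.exists_hilbertBasis_eigenvectors (hR.isSymmetric hA)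
  have hne : ∀ i, b i ≠ 0 := fun i => b.orthonormal.ne_zero i
  have hgr : ∀ i, ν i ≠ 0 ∧ (b i, (μ - (ν i)⁻¹) • b i) ∈ A.graph := fun i =>
    hR.mem_graph (hne i) (hν i)
  let f : ι → ℝ := fun i => μ - (ν i)⁻¹
  have hinf : Infinite ι := by
    by_contra hfin
    rw [not_infinite_iff_finite] at hfin
    have := Fintype.ofFinite ι
    exact hH (b.toOrthonormalBasis.toBasis.finiteDimensional_of_finite)
  -- `T 1` multiplies the unit vector `b i` by `e^{f i}`, and `e^{f i} ≥ f i + 1`.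
  have hup : ∀ i, f i ≤ ‖T 1‖ := by
    intro i
    have h1 := hT.apply_eigenvector hAT (hgr i).2 zero_le_one
    have h2 := (T 1).le_opNorm (b i)
    rw [h1, norm_smul, b.orthonormal.1 i, mul_one, mul_one, mul_one, Real.norm_eq_abs,
      Real.abs_exp] at h2
    have h3 := Real.add_one_le_exp (μ - (ν i)⁻¹)
    simp only [f]
    linarith
  have hsub : ∀ c : ℝ, {i | c ≤ f i}.Finite := by
    intro c
    -- If `c ≤ μ - ν⁻¹ ≤ ‖T 1‖`, then `|ν⁻¹| ≤ B`. So `|ν|` stays away from 0, which compactness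
    -- permits for finitely many indices only.
    let B : ℝ := 1 + |μ| + |c| + ‖T 1‖
    have hB : 0 < B := by positivity
    refine (hRc.finite_setOf_le_abs_eigenvalue b.orthonormal hν (inv_pos.mpr hB)).subset ?_
    intro i hi
    have hi' : c ≤ μ - (ν i)⁻¹ := hi
    have h1 : μ - (ν i)⁻¹ ≤ ‖T 1‖ := hup i
    have h2 : |(ν i)⁻¹| ≤ B := by
      rw [abs_le]
      simp only [B]
      constructor <;> linarith [neg_abs_le μ, le_abs_self μ, neg_abs_le c, norm_nonneg (T 1),
        abs_nonneg c]
    change B⁻¹ ≤ |ν i|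
    rw [abs_inv] at h2
    exact inv_le_of_inv_le₀ (abs_pos.mpr (hgr i).1) h2
  obtain ⟨g, hg⟩ := exists_equiv_nat_antitone f hsub
  have hspan : (⊤ : Submodule ℝ H) ≤ (Submodule.span ℝ (range (b ∘ g))).topologicalClosure := by
    rw [g.surjective.range_comp, b.dense_span]
  let e := HilbertBasis.mk (b.orthonormal.comp g g.injective) hspan
  have he : ∀ n, e n = b (g n) := fun n => by simp [e]
  refine ⟨f ∘ g, e, hg, ?_, fun n => ?_⟩
  · rw [tendsto_atBot]
    intro c
    have : {n | c < (f ∘ g) n}.Finite :=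
      ((hsub c).preimage g.injective.injOn).subset fun n (hn : c < _) => hn.le
    have h := this.compl_mem_cofinite
    rw [Nat.cofinite_eq_atTop] at h
    filter_upwards [h] with n hn
    simpa using hn
  · rw [he]
    exact (hgr (g n)).2

end Eigenbasis

/-! ### The weighted space is infinite-dimensional -/

section Weighted

variable {ρ : ℝ → ℝ}

theorem weightedMeasure_absolutelyContinuous (ρ : ℝ → ℝ) :
    weightedMeasure ρ ≪ volume.restrict (Ioo 0 1) :=
  withDensity_absolutelyContinuous _ _

theorem ae_weightedMeasure_mem (ρ : ℝ → ℝ) : ∀ᵐ ξ ∂weightedMeasure ρ, ξ ∈ Ioo (0 : ℝ) 1 :=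
  (weightedMeasure_absolutelyContinuous ρ).ae_le (ae_restrict_mem measurableSet_Ioo)

theorem isFiniteMeasure_weightedMeasure (hρ : ContinuousOn ρ (Icc 0 1)) :
    IsFiniteMeasure (weightedMeasure ρ) := by
  have h : IntegrableOn ρ (Ioo 0 1) :=
    (hρ.integrableOn_compact isCompact_Icc).mono_set Ioo_subset_Icc_self
  exact isFiniteMeasure_withDensity_ofReal h.2

theorem weightedMeasure_Ioo_ne_zero (hρ : ContinuousOn ρ (Icc 0 1))
    (hpos : ∀ ξ ∈ Icc (0 : ℝ) 1, 0 < ρ ξ) {a b : ℝ} (ha : 0 ≤ a) (hab : a < b) (hb : b ≤ 1) :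
    weightedMeasure ρ (Ioo a b) ≠ 0 := by
  intro h0
  have hac : volume.restrict (Ioo (0 : ℝ) 1) ≪ weightedMeasure ρ := by
    apply withDensity_absolutelyContinuous'
    · exact ((hρ.mono Ioo_subset_Icc_self).aemeasurable measurableSet_Ioo).ennreal_ofReal
    · filter_upwards [ae_restrict_mem measurableSet_Ioo] with ξ hξ
      simpa using hpos ξ (Ioo_subset_Icc_self hξ)
  have h1 := hac h0
  rw [Measure.restrict_apply measurableSet_Ioo,
    inter_eq_left.mpr (Ioo_subset_Ioo ha hb), Real.volume_Ioo] at h1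
  simp at h1
  linarith

/-- The indicators of the disjoint intervals `(1/(n+2), 1/(n+1))` are nonzero and pairwise
orthogonal. Infinite dimension is what allows the eigenbasis to be indexed by `ℕ`. -/
theorem not_finiteDimensional_weightedL2 (hρ : ContinuousOn ρ (Icc 0 1))
    (hpos : ∀ ξ ∈ Icc (0 : ℝ) 1, 0 < ρ ξ) : ¬ FiniteDimensional ℝ (WeightedL2 ρ) := by
  intro hfd
  have := isFiniteMeasure_weightedMeasure hρ
  let I : ℕ → Set ℝ := fun n => Ioo (1 / ((n : ℝ) + 2)) (1 / ((n : ℝ) + 1))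
  have hI : ∀ n, MeasurableSet (I n) := fun n => measurableSet_Ioo
  have hdisj : ∀ m n, m < n → Disjoint (I m) (I n) := by
    intro m n hmn
    rw [Set.disjoint_left]
    intro x hx hx'
    have h1 : 1 / ((m : ℝ) + 2) < x := hx.1
    have h2 : x < 1 / ((n : ℝ) + 1) := hx'.2
    have h3 : 1 / ((n : ℝ) + 1) ≤ 1 / ((m : ℝ) + 2) := by
      apply one_div_le_one_div_of_le (by positivity)
      have : (m : ℝ) + 1 ≤ n := by exact_mod_cast hmn
      linarith
    linarith
  let v : ℕ → WeightedL2 ρ := fun n => indicatorConstLp 2 (hI n) (measure_ne_top _ _) (1 : ℝ)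
  have hv0 : ∀ n, v n ≠ 0 := by
    intro n h
    have h1 : ‖v n‖ = 0 := by simp [h]
    have h2 : weightedMeasure ρ (I n) ≠ 0 := by
      refine weightedMeasure_Ioo_ne_zero hρ hpos (by positivity) ?_ ?_
      · apply one_div_lt_one_div_of_lt (by positivity); linarith
      · rw [div_le_one (by positivity)]
        linarith [(Nat.cast_nonneg n : (0 : ℝ) ≤ n)]
    rw [norm_indicatorConstLp (by simp) (by simp)] at h1
    simp only [norm_one, one_mul] at h1
    have h3 : 0 < (weightedMeasure ρ).real (I n) := by
      rw [Measure.real, ENNReal.toReal_pos_iff]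
      exact ⟨pos_iff_ne_zero.mpr h2, measure_lt_top _ _⟩
    exact (Real.rpow_pos_of_pos h3 _).ne' h1
  have horth : ∀ m n, m < n → inner ℝ (v m) (v n) = 0 := by
    intro m n hmn
    rw [L2.inner_indicatorConstLp_eq_setIntegral_inner]
    apply integral_eq_zero_of_ae
    filter_upwards [ae_restrict_mem (hI m),
      ae_restrict_of_ae (indicatorConstLp_coeFn (p := 2) (hs := hI n)
        (hμs := measure_ne_top (weightedMeasure ρ) _) (c := (1 : ℝ)))] with x hx hx'
    rw [hx', indicator_of_notMem (Set.disjoint_left.mp (hdisj m n hmn) hx)]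
    simp
  have hli : LinearIndependent ℝ v := by
    apply linearIndependent_of_ne_zero_of_inner_eq_zero hv0
    intro m n hmn
    rcases lt_or_gt_of_ne hmn with h | h
    · exact horth m n h
    · rw [real_inner_comm]; exact horth n m h
  exact Module.Finite.not_linearIndependent_of_infinite v hli

/-! ### Multiplication by continuous functions -/

theorem aestronglyMeasurable_of_continuousOn {g : ℝ → ℝ} (hg : ContinuousOn g (Icc 0 1)) :
    AEStronglyMeasurable g (weightedMeasure ρ) :=
  ((hg.mono Ioo_subset_Icc_self).aestronglyMeasurable measurableSet_Ioo).mono_ac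
    (weightedMeasure_absolutelyContinuous ρ)

theorem memLp_mul {g : ℝ → ℝ} (hg : ContinuousOn g (Icc 0 1)) (x : WeightedL2 ρ) :
    MemLp (fun ξ => g ξ * x ξ) 2 (weightedMeasure ρ) := by
  obtain ⟨c, hc⟩ := isCompact_Icc.exists_bound_of_continuousOn hg
  refine (Lp.memLp x).of_le_mul (c := c)
    ((aestronglyMeasurable_of_continuousOn hg).mul (Lp.aestronglyMeasurable x)) ?_
  filter_upwards [ae_weightedMeasure_mem ρ] with ξ hξ
  rw [norm_mul]
  gcongr
  exact hc ξ (Ioo_subset_Icc_self hξ)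

open Classical in
/-- The product of a function `g` and an element of `L²_ρ(0, 1)` (zero if it is not in
`L²_ρ(0, 1)`). -/
noncomputable def mulLp (g : ℝ → ℝ) (x : WeightedL2 ρ) : WeightedL2 ρ :=
  if h : MemLp (fun ξ => g ξ * x ξ) 2 (weightedMeasure ρ) then h.toLp _ else 0

theorem coeFn_mulLp {g : ℝ → ℝ} (hg : ContinuousOn g (Icc 0 1)) (x : WeightedL2 ρ) :
    mulLp g x =ᵐ[weightedMeasure ρ] fun ξ => g ξ * x ξ := by
  rw [mulLp, dif_pos (memLp_mul hg x)]
  exact MemLp.coeFn_toLp _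

theorem norm_mulLp_le {g : ℝ → ℝ} (hg : ContinuousOn g (Icc 0 1)) (x : WeightedL2 ρ) {c : ℝ}
    (hc : ∀ ξ ∈ Icc (0 : ℝ) 1, |g ξ| ≤ c) : ‖mulLp g x‖ ≤ c * ‖x‖ := by
  apply Lp.norm_le_mul_norm_of_ae_le_mul
  filter_upwards [ae_weightedMeasure_mem ρ, coeFn_mulLp hg x] with ξ hξ h
  rw [h, norm_mul]
  gcongr
  exact hc ξ (Ioo_subset_Icc_self hξ)

theorem mulLp_sub {g h : ℝ → ℝ} (hg : ContinuousOn g (Icc 0 1)) (hh : ContinuousOn h (Icc 0 1))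
    (x : WeightedL2 ρ) : mulLp (fun ξ => g ξ - h ξ) x = mulLp g x - mulLp h x := by
  apply Lp.ext
  filter_upwards [coeFn_mulLp hg x, coeFn_mulLp hh x, coeFn_mulLp (hg.sub hh) x,
    Lp.coeFn_sub (mulLp g x) (mulLp h x)] with ξ h1 h2 h3 h4
  have h3' : mulLp (fun ξ => g ξ - h ξ) x ξ = (g ξ - h ξ) * x ξ := h3
  rw [h3', h4, Pi.sub_apply, h1, h2]
  ring

theorem mulLp_const (c : ℝ) (x : WeightedL2 ρ) : mulLp (fun _ => c) x = c • x := by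
  apply Lp.ext
  filter_upwards [coeFn_mulLp continuousOn_const x, Lp.coeFn_smul c x] with ξ h1 h2
  rw [h1, h2, Pi.smul_apply, smul_eq_mul]

end Weighted

/-! ### Delayed inputs -/

/-- The abstract properties of the map `V` that takes a control signal `w` to the delayed input
`V w`, when the delay stays within `δ` of `D₀`. -/
structure IsDelayedInput {H : Type*} [NormedAddCommGroup H] [InnerProductSpace ℝ H]
    (e : HilbertBasis ℕ ℝ H) {N : ℕ} (D₀ δ : ℝ)
    (V : (ℝ → EuclideanSpace ℝ (Fin N)) → ℝ → H) : Prop where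
  continuousOn : ∀ {w : ℝ → EuclideanSpace ℝ (Fin N)}, Continuous w → ContinuousOn (V w) (Ici 0)
  sub : ∀ {w w' : ℝ → EuclideanSpace ℝ (Fin N)}, Continuous w → Continuous w' → ∀ {t}, 0 ≤ t →
    V (fun s => w s - w' s) t = V w t - V w' t
  const : ∀ c {t}, 0 ≤ t → V (fun _ => c) t = synthesis e c
  norm_le : ∀ {w : ℝ → EuclideanSpace ℝ (Fin N)}, Continuous w → ∀ {t}, 0 ≤ t → ∀ {c : Fin N → ℝ},
    (∀ k τ, |τ - D₀| ≤ δ → |w (t - τ) k| ≤ c k) → ‖V w t‖ ≤ ∑ k, c k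

/-- The delayed input `[v(t)](ξ) = ∑ₖ w_k(t - D(t, ξ)) e_k(ξ)`. -/
noncomputable def delayedInput {ρ : ℝ → ℝ} (e : HilbertBasis ℕ ℝ (WeightedL2 ρ)) {N : ℕ}
    (D : ℝ → ℝ → ℝ) (w : ℝ → EuclideanSpace ℝ (Fin N)) (t : ℝ) : WeightedL2 ρ :=
  ∑ k : Fin N, mulLp (fun ξ => w (t - D t ξ) k) (e k)

section DelayedInput

variable {ρ : ℝ → ℝ} (e : HilbertBasis ℕ ℝ (WeightedL2 ρ)) {N : ℕ} {D₀ δ : ℝ} {D : ℝ → ℝ → ℝ}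

theorem IsAdmissibleDelay.continuousOn_comp (hD : IsAdmissibleDelay D₀ δ D)
    {w : ℝ → EuclideanSpace ℝ (Fin N)} (hw : Continuous w) {t : ℝ} (ht : 0 ≤ t) (k : Fin N) :
    ContinuousOn (fun ξ => w (t - D t ξ) k) (Icc 0 1) := by
  have h1 : ContinuousOn (fun ξ : ℝ => D t ξ) (Icc 0 1) :=
    hD.continuousOn.comp (f := fun ξ : ℝ => (t, ξ)) (by fun_prop) fun ξ hξ => ⟨ht, hξ⟩
  have h2 : Continuous fun s => w s k := by fun_prop
  exact h2.comp_continuousOn (continuousOn_const.sub h1)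

/-- Joint continuity on a product with a compact factor allows currying: time is sent continuously
into `C([0,1])` with the sup norm. Clamping time at 0 removes the restriction to `t ≥ 0`. -/
theorem IsAdmissibleDelay.continuous_extend (hD : IsAdmissibleDelay D₀ δ D)
    {w : ℝ → EuclideanSpace ℝ (Fin N)} (hw : Continuous w) (k : Fin N) :
    Continuous fun p : ℝ × Icc (0 : ℝ) 1 => w (max p.1 0 - D (max p.1 0) p.2) k := by
  have h0 : Continuous fun p : ℝ × Icc (0 : ℝ) 1 => max p.1 0 := by fun_prop
  have h1 : Continuous fun p : ℝ × Icc (0 : ℝ) 1 => D (max p.1 0) p.2 :=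
    hD.continuousOn.comp_continuous (f := fun p : ℝ × Icc (0 : ℝ) 1 => (max p.1 0, (p.2 : ℝ)))
      (h0.prodMk (continuous_subtype_val.comp continuous_snd))
      fun p => ⟨mem_Ici.mpr (le_max_right _ _), p.2.2⟩
  have h2 : Continuous fun s => w s k := by fun_prop
  exact h2.comp (h0.sub h1)

theorem coeFn_delayedInput (hD : IsAdmissibleDelay D₀ δ D)
    {w : ℝ → EuclideanSpace ℝ (Fin N)} (hw : Continuous w) {t : ℝ} (ht : 0 ≤ t) :
    delayedInput e D w t =ᵐ[weightedMeasure ρ] fun ξ => ∑ k : Fin N, w (t - D t ξ) k * e k ξ := by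
  have h1 := Lp.coeFn_finsetSum (Finset.univ : Finset (Fin N))
    fun k : Fin N => mulLp (fun ξ => w (t - D t ξ) k) (e k)
  have h2 : ∀ᵐ ξ ∂weightedMeasure ρ, ∀ k : Fin N,
      mulLp (fun ξ => w (t - D t ξ) k) (e k) ξ = w (t - D t ξ) k * e k ξ :=
    ae_all_iff.mpr fun k => coeFn_mulLp (hD.continuousOn_comp hw ht k) (e k)
  filter_upwards [h1, h2] with ξ h1 h2
  rw [delayedInput, h1]
  simp [h2]

theorem IsAdmissibleDelay.isDelayedInput (hD : IsAdmissibleDelay D₀ δ D) :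
    IsDelayedInput e (N := N) D₀ δ (delayedInput e D) := by
  have hsub : ∀ {w w' : ℝ → EuclideanSpace ℝ (Fin N)}, Continuous w → Continuous w' →
      ∀ {t}, 0 ≤ t → delayedInput e D (fun s => w s - w' s) t
        = delayedInput e D w t - delayedInput e D w' t := by
    intro w w' hw hw' t ht
    simp only [delayedInput, ← Finset.sum_sub_distrib]
    refine Finset.sum_congr rfl fun k _ => ?_
    exact mulLp_sub (hD.continuousOn_comp hw ht k) (hD.continuousOn_comp hw' ht k) (e k)
  refine ⟨?_, hsub, ?_, ?_⟩
  · intro w hw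
    let G : Fin N → C(ℝ × Icc (0 : ℝ) 1, ℝ) := fun k => ⟨_, hD.continuous_extend hw k⟩
    have hG : ∀ k, Continuous fun t => (G k).curry t := fun k => (G k).curry.continuous
    intro t₀ ht₀
    have ht₀' : (0 : ℝ) ≤ t₀ := ht₀
    rw [ContinuousWithinAt, tendsto_iff_norm_sub_tendsto_zero]
    -- Since `‖e k‖ = 1`, the change of each summand of the input is at most the uniform distance of
    -- the multipliers.
    have hlim : Tendsto (fun t => ∑ k, ‖(G k).curry t - (G k).curry t₀‖) (𝓝[Ici 0] t₀) (𝓝 0) := by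
      have : Continuous fun t => ∑ k, ‖(G k).curry t - (G k).curry t₀‖ :=
        continuous_finsetSum _ fun k _ => ((hG k).sub continuous_const).norm
      have h := (this.tendsto t₀).mono_left (nhdsWithin_le_nhds (s := Ici 0))
      simpa using h
    refine squeeze_zero' (Eventually.of_forall fun t => norm_nonneg _) ?_ hlim
    filter_upwards [self_mem_nhdsWithin] with t ht
    have ht' : (0 : ℝ) ≤ t := ht
    simp only [delayedInput, ← Finset.sum_sub_distrib]
    refine norm_sum_le_of_le _ fun k _ => ?_
    have h1 := hD.continuousOn_comp hw ht' k
    have h2 := hD.continuousOn_comp hw ht₀' k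
    rw [← mulLp_sub h1 h2]
    refine (norm_mulLp_le (h1.sub h2) (e k) (c := ‖(G k).curry t - (G k).curry t₀‖) ?_).trans ?_
    · intro ξ hξ
      have := ((G k).curry t - (G k).curry t₀).norm_coe_le_norm ⟨ξ, hξ⟩
      simpa [G, max_eq_left ht', max_eq_left ht₀'] using! this
    · rw [e.orthonormal.1, mul_one]
  · intro c t ht
    simp [delayedInput, synthesis, mulLp_const]
  · intro w hw t ht c hc
    refine norm_sum_le_of_le _ fun k _ => ?_
    refine (norm_mulLp_le (hD.continuousOn_comp hw ht k) (e k) (c := c k) ?_).trans ?_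
    · exact fun ξ hξ => hc k _ (hD.abs_sub_le t ξ ht hξ)
    · rw [e.orthonormal.1, mul_one]

end DelayedInput

/-! ### Exponentials of bounded operators -/

section OperatorExp

variable {E : Type*} [NormedAddCommGroup E] [NormedSpace ℝ E] [CompleteSpace E]

/-- The uniformly continuous group `t ↦ e^{tL}`. -/
noncomputable def expFlow (L : E →L[ℝ] E) (t : ℝ) : E →L[ℝ] E := NormedSpace.exp (t • L)

theorem hasDerivAt_expFlow (L : E →L[ℝ] E) (t : ℝ) :
    HasDerivAt (expFlow L) (L * expFlow L t) t :=
  hasDerivAt_exp_smul_const' L t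

theorem continuous_expFlow (L : E →L[ℝ] E) : Continuous (expFlow L) :=
  continuous_iff_continuousAt.mpr fun t => (hasDerivAt_expFlow L t).continuousAt

omit [CompleteSpace E] in
theorem expFlow_zero (L : E →L[ℝ] E) : expFlow L 0 = 1 := by simp [expFlow]

theorem expFlow_add (L : E →L[ℝ] E) (s t : ℝ) :
    expFlow L (s + t) = expFlow L s * expFlow L t := by
  let _ : NormedAlgebra ℚ (E →L[ℝ] E) := NormedAlgebra.restrictScalars ℚ ℝ _
  rw [expFlow, add_smul, NormedSpace.exp_add_of_commute]
  · rfl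
  · exact ((Commute.refl L).smul_left s).smul_right t

theorem expFlow_apply_apply (L : E →L[ℝ] E) (s t : ℝ) (x : E) :
    expFlow L s (expFlow L t x) = expFlow L (s + t) x := by
  rw [expFlow_add]; rfl

/-- Termwise comparison of the exponential series without their constant terms. -/
theorem norm_expFlow_sub_one_le (L : E →L[ℝ] E) (t : ℝ) :
    ‖expFlow L t - 1‖ ≤ Real.exp (‖L‖ * |t|) - 1 := by
  have h1 := (hasSum_nat_add_iff' 1).mpr
    (NormedSpace.exp_series_hasSum_exp' (𝕂 := ℝ) (t • L))
  have h2 := (hasSum_nat_add_iff' 1).mpr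
    (NormedSpace.exp_series_hasSum_exp' (𝕂 := ℝ) (‖L‖ * |t|))
  rw [← Real.exp_eq_exp_ℝ] at h2
  simp only [Finset.range_one, Finset.sum_singleton, Nat.factorial_zero, Nat.cast_one, inv_one,
    pow_zero, one_smul] at h1 h2
  refine h1.norm_le_of_bounded h2 fun n => ?_
  rw [norm_smul, Real.norm_of_nonneg (by positivity), smul_eq_mul]
  refine mul_le_mul_of_nonneg_left ((norm_pow_le' _ n.succ_pos).trans (le_of_eq ?_))
    (by positivity)
  rw [norm_smul, Real.norm_eq_abs, mul_comm]

theorem norm_expFlow_le (L : E →L[ℝ] E) (t : ℝ) :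
    ‖expFlow L t‖ ≤ Real.exp (‖L‖ * |t|) := by
  have h1 : ‖(1 : E →L[ℝ] E)‖ ≤ 1 := ContinuousLinearMap.norm_id_le
  have h2 := norm_expFlow_sub_one_le L t
  have h3 := norm_add_le (expFlow L t - 1) 1
  rw [sub_add_cancel] at h3
  linarith

theorem hasDerivAt_expFlow_apply (L : E →L[ℝ] E) {y : ℝ → E} {y' : E} {t : ℝ}
    (hy : HasDerivAt y y' t) :
    HasDerivAt (fun s => expFlow L s (y s)) (L (expFlow L t (y t)) + expFlow L t y') t :=
  (hasDerivAt_expFlow L t).clm_apply hy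

/-- It moves the dependence on `t` out of the integrand, so that integrals with variable limits can
be differentiated by the fundamental theorem of calculus. -/
theorem integral_expFlow_sub (L : E →L[ℝ] E) {g : ℝ → E} (hg : Continuous g) (a b t : ℝ) :
    ∫ s in a..b, expFlow L (t - s) (g s) = expFlow L t (∫ s in a..b, expFlow L (-s) (g s)) := by
  have hc : Continuous fun s => expFlow L (-s) (g s) :=
    ((continuous_expFlow L).comp continuous_neg).clm_apply hg
  rw [← ContinuousLinearMap.intervalIntegral_comp_comm _ (hc.intervalIntegrable a b)]
  simp_rw [expFlow_apply_apply, sub_eq_add_neg]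

/-- Variation of constants. -/
theorem eq_expFlow_add_integral (L : E →L[ℝ] E) {y g : ℝ → E} (hg : Continuous g) {a b : ℝ}
    (hab : a ≤ b) (hy : ∀ t ∈ Icc a b, HasDerivAt y (L (y t) + g t) t) :
    y b = expFlow L (b - a) (y a) + ∫ s in a..b, expFlow L (b - s) (g s) := by
  have hc : Continuous fun s => expFlow L (-s) (g s) :=
    ((continuous_expFlow L).comp continuous_neg).clm_apply hg
  have hcomm : ∀ t x, expFlow L t (L x) = L (expFlow L t x) := by
    intro t x
    have h : Commute (expFlow L t) L := ((Commute.refl L).smul_left t).exp_left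
    exact congrArg (fun F : E →L[ℝ] E => F x) h.eq
  have h1 : ∀ t ∈ uIcc a b,
      HasDerivAt (fun s => expFlow L (-s) (y s)) (expFlow L (-t) (g t)) t := by
    intro t ht
    rw [uIcc_of_le hab] at ht
    have h2 : HasDerivAt (fun s => expFlow L (-s)) (-(L * expFlow L (-t))) t := by
      have := (hasDerivAt_expFlow L (-t)).scomp t (hasDerivAt_neg t)
      rwa [neg_one_smul] at this
    convert! h2.clm_apply (hy t ht) using 1
    rw [map_add, hcomm]
    simp
  have h3 := intervalIntegral.integral_eq_sub_of_hasDerivAt h1 (hc.intervalIntegrable a b)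
  rw [integral_expFlow_sub L hg, h3, map_sub, expFlow_apply_apply, expFlow_apply_apply]
  simp [expFlow_zero, sub_eq_add_neg]

end OperatorExp

/-- An exponential bound for the integral of a function with an exponential bound. -/
theorem norm_intervalIntegral_le_exp {E : Type*} [NormedAddCommGroup E] [NormedSpace ℝ E]
    {f : ℝ → E} {a t r C : ℝ} (hat : a ≤ t) (hr : 0 < r) (hC : 0 ≤ C)
    (hf : ∀ s ∈ Icc a t, ‖f s‖ ≤ C * Real.exp (r * s)) :
    ‖∫ s in a..t, f s‖ ≤ C / r * Real.exp (r * t) := by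
  have h1 := intervalIntegral.norm_integral_le_of_norm_le (μ := volume) hat
    (Eventually.of_forall fun s (hs : s ∈ Ioc a t) => hf s (Ioc_subset_Icc_self hs))
    (Continuous.intervalIntegrable (by fun_prop) a t)
  refine h1.trans ?_
  rw [intervalIntegral.integral_const_mul,
    intervalIntegral.integral_comp_mul_left (fun x => Real.exp x) hr.ne', integral_exp, smul_eq_mul,
    ← mul_assoc, ← div_eq_mul_inv]
  gcongr
  linarith [Real.exp_pos (r * a)]

/-! ### Coordinates in a Hilbert basis -/

section Modes

variable {H : Type*} [NormedAddCommGroup H] [InnerProductSpace ℝ H]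
  (e : HilbertBasis ℕ ℝ H) (N : ℕ)

/-- The map `modes` as a continuous linear map. -/
noncomputable def modesL : H →L[ℝ] EuclideanSpace ℝ (Fin N) :=
  (EuclideanSpace.equiv (Fin N) ℝ).symm.toContinuousLinearMap.comp
    (ContinuousLinearMap.pi fun k : Fin N => innerSL ℝ (e k))

theorem modesL_apply (x : H) (k : Fin N) : modesL e N x k = inner ℝ x (e k) := by
  rw [real_inner_comm]; rfl

theorem modesL_eq (x : H) : modesL e N x = modes e N x := by
  ext k
  exact modesL_apply e N x k

theorem norm_modesL_le (x : H) : ‖modesL e N x‖ ≤ ‖x‖ := by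
  rw [← sq_le_sq₀ (norm_nonneg _) (norm_nonneg _), EuclideanSpace.norm_sq_eq]
  have h := (e.orthonormal.comp (fun k : Fin N => (k : ℕ)) Fin.val_injective).sum_inner_products_le x
    (s := Finset.univ)
  simpa [modesL_apply, real_inner_comm] using h

variable {N}

theorem inner_synthesis (w : EuclideanSpace ℝ (Fin N)) (n : ℕ) :
    inner ℝ (synthesis e w) (e n) = if h : n < N then w ⟨n, h⟩ else 0 := by
  have h1 : ∀ k : Fin N, inner ℝ (w k • e k) (e n) = if (k : ℕ) = n then w k else 0 := by
    intro k
    rw [inner_smul_left, orthonormal_iff_ite.mp e.orthonormal]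
    simp
  rw [synthesis, sum_inner, Finset.sum_congr rfl fun k _ => h1 k]
  split_ifs with h
  · rw [Finset.sum_eq_single ⟨n, h⟩]
    · simp
    · intro k _ hk
      rw [if_neg]
      exact fun h' => hk (Fin.ext h')
    · simp
  · refine Finset.sum_eq_zero fun k _ => if_neg ?_
    have := k.2
    omega

theorem modesL_synthesis (w : EuclideanSpace ℝ (Fin N)) : modesL e N (synthesis e w) = w := by
  ext k
  rw [modesL_apply, inner_synthesis, dif_pos k.2]

theorem norm_synthesis (w : EuclideanSpace ℝ (Fin N)) : ‖synthesis e w‖ = ‖w‖ := by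
  have h := (e.orthonormal.comp (fun k : Fin N => (k : ℕ)) Fin.val_injective).inner_sum
    (fun k => w k) (fun k => w k) Finset.univ
  have h2 : ‖synthesis e w‖ ^ 2 = ‖w‖ ^ 2 := by
    rw [← real_inner_self_eq_norm_sq, EuclideanSpace.norm_sq_eq]
    refine h.trans ?_
    simp [sq]
  exact (pow_left_inj₀ (norm_nonneg _) (norm_nonneg _) two_ne_zero).mp h2

/-- The projection on the closed span of the basis vectors of index at least `N`. -/
noncomputable def tailL (N : ℕ) : H →L[ℝ] H :=
  ContinuousLinearMap.id ℝ H - ∑ k : Fin N, (innerSL ℝ (e k)).smulRight (e k)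

theorem tailL_apply (x : H) : tailL e N x = x - synthesis e (modesL e N x) := by
  simp [tailL, synthesis, modesL_apply, real_inner_comm]

theorem inner_tailL (x : H) (n : ℕ) :
    inner ℝ (tailL e N x) (e n) = if n < N then 0 else inner ℝ x (e n) := by
  rw [tailL_apply, inner_sub_left, inner_synthesis]
  split_ifs with h
  · simp [modesL_apply]
  · simp

theorem norm_le_modesL_add_tailL (x : H) : ‖x‖ ≤ ‖modesL e N x‖ + ‖tailL e N x‖ := by
  have h : x = synthesis e (modesL e N x) + tailL e N x := by rw [tailL_apply]; abel
  calc ‖x‖ = ‖synthesis e (modesL e N x) + tailL e N x‖ := by rw [← h]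
    _ ≤ _ := (norm_add_le _ _).trans (by rw [norm_synthesis])

/-- Parseval's identity for both vectors, compared term by term. -/
theorem norm_le_of_abs_inner_le {x y : H} {c : ℝ} (hc : 0 ≤ c)
    (h : ∀ n, |inner ℝ y (e n)| ≤ c * |inner ℝ x (e n)|) : ‖y‖ ≤ c * ‖x‖ := by
  have hs : ∀ z : H, HasSum (fun n => inner ℝ z (e n) ^ 2) (‖z‖ ^ 2) := by
    intro z
    have := e.hasSum_inner_mul_inner z z
    rw [real_inner_self_eq_norm_sq] at this
    convert! this using 2 with n
    rw [real_inner_comm z, sq]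
  rw [← sq_le_sq₀ (norm_nonneg _) (by positivity), mul_pow]
  refine hasSum_le ?_ (hs y) ((hs x).mul_left (c ^ 2))
  intro n
  rw [← mul_pow, sq_le_sq, abs_mul, abs_of_nonneg hc]
  exact h n

end Modes

/-! ### Diagonal semigroups and mild solutions -/

section Diagonal

theorem toEuclideanCLM_exp {N : ℕ} (B : Matrix (Fin N) (Fin N) ℝ) (t : ℝ) :
    Matrix.toEuclideanCLM (𝕜 := ℝ) (NormedSpace.exp (t • B))
      = expFlow (Matrix.toEuclideanCLM (𝕜 := ℝ) B) t := by
  -- Any normed algebra structure inducing the matrix topology will do here: it serves only to carry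
  -- the exponential through a continuous algebra homomorphism.
  let _ : NormedRing (Matrix (Fin N) (Fin N) ℝ) := Matrix.linftyOpNormedRing
  let _ : NormedAlgebra ℝ (Matrix (Fin N) (Fin N) ℝ) := Matrix.linftyOpNormedAlgebra
  let _ : NormedAlgebra ℚ (Matrix (Fin N) (Fin N) ℝ) := NormedAlgebra.restrictScalars ℚ ℝ _
  have hcont : Continuous (Matrix.toEuclideanCLM (n := Fin N) (𝕜 := ℝ)) :=
    LinearMap.continuous_of_finiteDimensional
      (Matrix.toEuclideanCLM (n := Fin N) (𝕜 := ℝ)).toAlgEquiv.toLinearMap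
  refine (NormedSpace.map_exp (Matrix.toEuclideanCLM (n := Fin N) (𝕜 := ℝ)) hcont (t • B)).trans ?_
  rw [map_smul]
  rfl

/-- The operator on `ℝ^N` with the matrix `diagMatrix lam N`. -/
noncomputable def diagOp (lam : ℕ → ℝ) (N : ℕ) :
    EuclideanSpace ℝ (Fin N) →L[ℝ] EuclideanSpace ℝ (Fin N) :=
  Matrix.toEuclideanCLM (𝕜 := ℝ) (diagMatrix lam N)

theorem expFlow_diagOp_apply (lam : ℕ → ℝ) {N : ℕ} (t : ℝ) (x : EuclideanSpace ℝ (Fin N))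
    (k : Fin N) : expFlow (diagOp lam N) t x k = Real.exp (lam k * t) * x k := by
  rw [diagOp, ← toEuclideanCLM_exp, diagMatrix, ← Matrix.diagonal_smul, Matrix.exp_diagonal]
  simp [Matrix.ofLp_toEuclideanCLM, Matrix.mulVec_diagonal]
  left
  rw [Real.exp_eq_exp_ℝ, mul_comm]

variable {H : Type*} [NormedAddCommGroup H] [InnerProductSpace ℝ H]
  {T : ℝ → H →L[ℝ] H} {e : HilbertBasis ℕ ℝ H} {lam : ℕ → ℝ}

theorem inner_apply_of_eigenbasis {F : H →L[ℝ] H} {c : ℕ → ℝ} (hF : ∀ n, F (e n) = c n • e n)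
    (x : H) (n : ℕ) : inner ℝ (F x) (e n) = c n * inner ℝ x (e n) := by
  have h := ((innerSL ℝ (e n)).comp F).hasSum (e.hasSum_repr x)
  have h2 : HasSum (fun i => e.repr x i * (c i * inner ℝ (e n) (e i))) (inner ℝ (e n) (F x)) := by
    simpa [hF, inner_smul_right] using! h
  rw [real_inner_comm]
  have h3 := hasSum_single (f := fun i => e.repr x i * (c i * inner ℝ (e n) (e i))) n (by
    intro i hi
    rw [e.orthonormal.2 hi.symm]
    simp)
  rw [h2.unique h3, e.repr_apply_apply, real_inner_self_eq_norm_sq, e.orthonormal.1,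
    real_inner_comm x]
  ring

theorem modesL_apply_eigenbasis (hT : ∀ t, 0 ≤ t → ∀ n, T t (e n) = Real.exp (lam n * t) • e n)
    {N : ℕ} {t : ℝ} (ht : 0 ≤ t) (x : H) :
    modesL e N (T t x) = expFlow (diagOp lam N) t (modesL e N x) := by
  ext k
  rw [expFlow_diagOp_apply, modesL_apply, modesL_apply, inner_apply_of_eigenbasis (hT t ht)]

/-- Every surviving coordinate has index at least `N`, so it is multiplied by at most `e^{λ_N t}` in
the zero-based indexing. -/
theorem norm_tailL_apply_le (hT : ∀ t, 0 ≤ t → ∀ n, T t (e n) = Real.exp (lam n * t) • e n)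
    (hlam : Antitone lam) {N : ℕ} {t : ℝ} (ht : 0 ≤ t) (x : H) :
    ‖tailL e N (T t x)‖ ≤ Real.exp (lam N * t) * ‖x‖ := by
  refine norm_le_of_abs_inner_le e (Real.exp_pos _).le fun n => ?_
  rw [inner_tailL]
  split_ifs with h
  · simp; positivity
  · rw [inner_apply_of_eigenbasis (hT t ht), abs_mul, Real.abs_exp]
    gcongr
    exact hlam (not_lt.mp h)

variable [CompleteSpace H]

theorem continuousOn_mildSolution (hT : IsC0Semigroup T) {v : ℝ → H} (hv : ContinuousOn v (Ici 0))
    (X₀ : H) : ContinuousOn (fun t => T t X₀ + ∫ s in (0 : ℝ)..t, T (t - s) (v s)) (Ici 0) := by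
  refine (hT.continuousOn X₀).add ?_
  have hv' : Continuous fun s => v (max s 0) :=
    hv.comp_continuous (by fun_prop) fun s => mem_Ici.mpr (le_max_right _ _)
  have h1 : Continuous (Function.uncurry fun t s : ℝ => T (max (t - s) 0) (v (max s 0))) :=
    hT.continuous_uncurry.comp (f := fun p : ℝ × ℝ => (p.1 - p.2, v (max p.2 0)))
      ((continuous_fst.sub continuous_snd).prodMk (hv'.comp continuous_snd))
  have h2 := intervalIntegral.continuous_parametric_intervalIntegral_of_continuous (μ := volume)
    (a₀ := 0) h1 continuous_id
  refine h2.continuousOn.congr fun t ht => ?_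
  refine intervalIntegral.integral_congr fun s hs => ?_
  rw [uIcc_of_le (mem_Ici.mp ht)] at hs
  simp only [max_eq_left hs.1, max_eq_left (sub_nonneg.mpr hs.2)]

theorem intervalIntegrable_mildSolution (hT : IsC0Semigroup T) {v : ℝ → H}
    (hv : ContinuousOn v (Ici 0)) {t : ℝ} (ht : 0 ≤ t) :
    IntervalIntegrable (fun s => T (t - s) (v s)) volume 0 t := by
  have hv' : Continuous fun s => v (max s 0) :=
    hv.comp_continuous (by fun_prop) fun s => mem_Ici.mpr (le_max_right _ _)
  have h1 : Continuous fun s : ℝ => T (max (t - s) 0) (v (max s 0)) :=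
    hT.continuous_uncurry.comp (f := fun s : ℝ => (t - s, v (max s 0)))
      ((continuous_const.sub continuous_id).prodMk hv')
  refine (h1.intervalIntegrable 0 t).congr fun s hs => ?_
  rw [uIoc_of_le ht] at hs
  simp only [max_eq_left hs.1.le, max_eq_left (sub_nonneg.mpr hs.2)]

theorem IsMildSolution.modesL_eq (hC : IsC0Semigroup T)
    (hT : ∀ t, 0 ≤ t → ∀ n, T t (e n) = Real.exp (lam n * t) • e n) {X₀ : H} {v X : ℝ → H}
    (h : IsMildSolution T X₀ v X) {N : ℕ} {t : ℝ} (ht : 0 ≤ t) :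
    modesL e N (X t) = expFlow (diagOp lam N) t (modesL e N X₀)
      + ∫ s in (0 : ℝ)..t, expFlow (diagOp lam N) (t - s) (modesL e N (v s)) := by
  rw [h.eq t ht, map_add, modesL_apply_eigenbasis hT ht,
    ← ContinuousLinearMap.intervalIntegral_comp_comm _
      (intervalIntegrable_mildSolution hC h.continuousOn_input ht)]
  congr 1
  refine intervalIntegral.integral_congr fun s hs => ?_
  rw [uIcc_of_le ht] at hs
  exact modesL_apply_eigenbasis hT (sub_nonneg.mpr hs.2) _

/-- Exponential decay of the stable part of a mild solution with an exponentially decaying input. -/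
theorem IsMildSolution.norm_tailL_le (hC : IsC0Semigroup T)
    (hT : ∀ t, 0 ≤ t → ∀ n, T t (e n) = Real.exp (lam n * t) • e n) (hlam : Antitone lam)
    {X₀ : H} {v X : ℝ → H} (h : IsMildSolution T X₀ v X) {N : ℕ} {κ B : ℝ} (hκ : κ < -lam N)
    (hB : 0 ≤ B) (hv : ∀ s, 0 ≤ s → ‖v s‖ ≤ B * Real.exp (-κ * s)) {t : ℝ} (ht : 0 ≤ t) :
    ‖tailL e N (X t)‖ ≤ (‖X₀‖ + B / (-lam N - κ)) * Real.exp (-κ * t) := by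
  rw [h.eq t ht, map_add, ← ContinuousLinearMap.intervalIntegral_comp_comm _
      (intervalIntegrable_mildSolution hC h.continuousOn_input ht), add_mul]
  refine (norm_add_le _ _).trans (add_le_add ?_ ?_)
  · refine (norm_tailL_apply_le hT hlam ht X₀).trans ?_
    rw [mul_comm]
    gcongr
    linarith
  -- The integrand is at most `e^{λ_N (t-s)} B e^{-κs}`, an exponential in `s` of rate `-λ_N - κ >
  -- 0`.
  · have h1 := norm_intervalIntegral_le_exp (f := fun s => tailL e N (T (t - s) (v s)))
      (C := B * Real.exp (lam N * t)) (r := -lam N - κ) ht (by linarith) (by positivity) (by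
        intro s hs
        refine (norm_tailL_apply_le hT hlam (sub_nonneg.mpr hs.2) _).trans ?_
        refine (mul_le_mul_of_nonneg_left (hv s hs.1) (Real.exp_pos _).le).trans (le_of_eq ?_)
        rw [mul_left_comm, mul_assoc, ← Real.exp_add, ← Real.exp_add]
        ring_nf)
    refine h1.trans (le_of_eq ?_)
    rw [div_mul_eq_mul_div, mul_assoc, ← Real.exp_add, div_mul_eq_mul_div]
    ring_nf

end Diagonal

/-! ### The predictor state -/

section Predictor

variable {H : Type*} [NormedAddCommGroup H] [InnerProductSpace ℝ H]
  {e : HilbertBasis ℕ ℝ H} {lam : ℕ → ℝ} {N : ℕ} {D₀ δ : ℝ}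
  {V : (ℝ → EuclideanSpace ℝ (Fin N)) → ℝ → H} {w w' : ℝ → EuclideanSpace ℝ (Fin N)}

/-- The first `N` modes of the delayed input, extended by a constant to negative times. -/
noncomputable def delayedModes (e : HilbertBasis ℕ ℝ H)
    (V : (ℝ → EuclideanSpace ℝ (Fin N)) → ℝ → H) (w : ℝ → EuclideanSpace ℝ (Fin N)) (t : ℝ) :
    EuclideanSpace ℝ (Fin N) :=
  modesL e N (V w (max t 0))

/-- The contribution of the recent control history to the predictor state. -/
noncomputable def historyIntegral (lam : ℕ → ℝ) (D₀ : ℝ) (w : ℝ → EuclideanSpace ℝ (Fin N))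
    (t : ℝ) : EuclideanSpace ℝ (Fin N) :=
  ∫ s in (t - D₀)..t, expFlow (diagOp lam N) (t - D₀ - s) (w s)

/-- The part of the predictor state that depends on the control signal. -/
noncomputable def forcedPredictor (e : HilbertBasis ℕ ℝ H) (lam : ℕ → ℝ) (D₀ : ℝ)
    (V : (ℝ → EuclideanSpace ℝ (Fin N)) → ℝ → H) (w : ℝ → EuclideanSpace ℝ (Fin N)) (t : ℝ) :
    EuclideanSpace ℝ (Fin N) :=
  (∫ s in (0 : ℝ)..t, expFlow (diagOp lam N) (t - s) (delayedModes e V w s))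
    + historyIntegral lam D₀ w t

/-- The Artstein transform of the first `N` modes of the state. -/
noncomputable def predictorState (e : HilbertBasis ℕ ℝ H) (lam : ℕ → ℝ) (D₀ : ℝ)
    (V : (ℝ → EuclideanSpace ℝ (Fin N)) → ℝ → H) (x₀ : EuclideanSpace ℝ (Fin N))
    (w : ℝ → EuclideanSpace ℝ (Fin N)) (t : ℝ) : EuclideanSpace ℝ (Fin N) :=
  expFlow (diagOp lam N) t x₀ + forcedPredictor e lam D₀ V w t

theorem IsDelayedInput.continuous_delayedModes (hV : IsDelayedInput e D₀ δ V) (hw : Continuous w) :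
    Continuous (delayedModes e V w) :=
  (modesL e N).continuous.comp <|
    (hV.continuousOn hw).comp_continuous (by fun_prop) fun s => mem_Ici.mpr (le_max_right _ _)

theorem continuous_expFlow_neg_apply {E : Type*} [NormedAddCommGroup E] [NormedSpace ℝ E]
    [CompleteSpace E] (L : E →L[ℝ] E) {g : ℝ → E} (hg : Continuous g) :
    Continuous fun s => expFlow L (-s) (g s) :=
  ((continuous_expFlow L).comp continuous_neg).clm_apply hg

/-- The dynamics of the predictor state. -/
theorem IsDelayedInput.hasDerivAt_predictorState (hV : IsDelayedInput e D₀ δ V)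
    (hw : Continuous w) (x₀ : EuclideanSpace ℝ (Fin N)) (t : ℝ) :
    HasDerivAt (predictorState e lam D₀ V x₀ w)
      (diagOp lam N (predictorState e lam D₀ V x₀ w t) + delayedModes e V w t
        + expFlow (diagOp lam N) (-D₀) (w t) - w (t - D₀)) t := by
  set L := diagOp lam N with hL
  have hm := hV.continuous_delayedModes hw
  have hc1 := continuous_expFlow_neg_apply L hm
  have hc2 := continuous_expFlow_neg_apply L hw
  -- The predictor state is `e^{tL} y(t)`. In `y` the history integral is split at 0, so that only
  -- limits of integration depend on `t`.
  let y : ℝ → EuclideanSpace ℝ (Fin N) := fun t =>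
    x₀ + (∫ s in (0 : ℝ)..t, expFlow L (-s) (delayedModes e V w s))
      + expFlow L (-D₀) ((∫ s in (0 : ℝ)..t, expFlow L (-s) (w s))
        - ∫ s in (0 : ℝ)..(t - D₀), expFlow L (-s) (w s))
  have hz : predictorState e lam D₀ V x₀ w = fun t => expFlow L t (y t) := by
    funext t
    simp only [y]
    rw [predictorState, forcedPredictor, historyIntegral, ← hL, integral_expFlow_sub L hm,
      integral_expFlow_sub L hw, intervalIntegral.integral_interval_sub_left
        (hc2.intervalIntegrable _ _) (hc2.intervalIntegrable _ _),
      map_add, map_add, expFlow_apply_apply, ← sub_eq_add_neg, add_assoc]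
  have hy : HasDerivAt y (expFlow L (-t) (delayedModes e V w t)
      + expFlow L (-D₀) (expFlow L (-t) (w t) - expFlow L (-(t - D₀)) (w (t - D₀)))) t := by
    have h1 := intervalIntegral.integral_hasDerivAt_right (hc1.intervalIntegrable 0 t)
      (hc1.stronglyMeasurableAtFilter _ _) hc1.continuousAt
    have h2 := intervalIntegral.integral_hasDerivAt_right (hc2.intervalIntegrable 0 t)
      (hc2.stronglyMeasurableAtFilter _ _) hc2.continuousAt
    have h3 := (intervalIntegral.integral_hasDerivAt_right (hc2.intervalIntegrable 0 (t - D₀))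
      (hc2.stronglyMeasurableAtFilter _ _) hc2.continuousAt).comp_sub_const t D₀
    exact (h1.const_add x₀).add ((expFlow L (-D₀)).hasFDerivAt.comp_hasDerivAt t (h2.sub h3))
  rw [hz]
  convert! hasDerivAt_expFlow_apply L hy using 1
  simp only [map_add, map_sub, expFlow_apply_apply]
  -- At the lower limit of the history integral the exponentials cancel, leaving exactly `-w(t -
  -- D₀)`: the nominal delayed input is traded for the undelayed term `e^{-D₀L} w(t)`.
  rw [show t + -t = 0 by ring, show t + (-D₀ + -t) = -D₀ by ring,
    show t + (-D₀ + -(t - D₀)) = 0 by ring, expFlow_zero]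
  simp only [one_apply_eq_self]
  abel

theorem IsDelayedInput.continuous_predictorState (hV : IsDelayedInput e D₀ δ V)
    (hw : Continuous w) (x₀ : EuclideanSpace ℝ (Fin N)) :
    Continuous (predictorState e lam D₀ V x₀ w) :=
  continuous_iff_continuousAt.mpr fun t => (hV.hasDerivAt_predictorState hw x₀ t).continuousAt

theorem IsDelayedInput.forcedPredictor_sub (hV : IsDelayedInput e D₀ δ V) (hw : Continuous w)
    (hw' : Continuous w') (t : ℝ) :
    forcedPredictor e lam D₀ V (fun s => w s - w' s) t
      = forcedPredictor e lam D₀ V w t - forcedPredictor e lam D₀ V w' t := by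
  have hm := hV.continuous_delayedModes hw
  have hm' := hV.continuous_delayedModes hw'
  have h0 : delayedModes e V (fun s => w s - w' s)
      = fun s => delayedModes e V w s - delayedModes e V w' s := by
    funext s
    rw [delayedModes, hV.sub hw hw' (le_max_right _ _), map_sub]
    rfl
  have hint : ∀ {g : ℝ → EuclideanSpace ℝ (Fin N)}, Continuous g → ∀ a b c : ℝ,
      IntervalIntegrable (fun s => expFlow (diagOp lam N) (c - s) (g s)) volume a b :=
    fun hg a b c => Continuous.intervalIntegrable
      (((continuous_expFlow _).comp (continuous_const.sub continuous_id)).clm_apply hg) a b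
  simp only [forcedPredictor, historyIntegral, h0, map_sub]
  rw [intervalIntegral.integral_sub (hint hm _ _ _) (hint hm' _ _ _),
    intervalIntegral.integral_sub (hint hw _ _ _) (hint hw' _ _ _)]
  abel

/-- A bound for the delayed input in terms of an exponential bound for the control signal. -/
theorem IsDelayedInput.norm_le_exp (hV : IsDelayedInput e D₀ δ V) (hδ : δ ≤ D₀)
    (hw : Continuous w) {γ B t : ℝ} (hγ : 0 ≤ γ) (hB : 0 ≤ B) (ht : 0 ≤ t)
    (h : ∀ s ≤ t, ‖w s‖ ≤ B * Real.exp (γ * s)) : ‖V w t‖ ≤ N * B * Real.exp (γ * t) := by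
  have h1 := hV.norm_le hw ht (c := fun _ => B * Real.exp (γ * t)) (by
    intro k τ hτ
    -- This is where `δ ≤ D₀` makes the input causal.
    have hτ' : 0 ≤ τ := by linarith [(abs_le.mp hτ).1]
    refine (PiLp.norm_apply_le (w (t - τ)) k).trans ((h _ (by linarith)).trans ?_)
    gcongr
    linarith)
  simpa [mul_assoc] using h1

theorem norm_historyIntegral_le (hD₀ : 0 ≤ D₀) {γ B t : ℝ} (hγ : 0 < γ)
    (hB : 0 ≤ B) (h : ∀ s ≤ t, ‖w s‖ ≤ B * Real.exp (γ * s)) :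
    ‖historyIntegral lam D₀ w t‖
      ≤ Real.exp (‖diagOp lam N‖ * D₀) * B / γ * Real.exp (γ * t) := by
  refine norm_intervalIntegral_le_exp (by linarith) hγ (by positivity) fun s hs => ?_
  refine (ContinuousLinearMap.le_opNorm _ _).trans ?_
  rw [mul_assoc]
  refine mul_le_mul ((norm_expFlow_le _ _).trans ?_) (h s hs.2) (norm_nonneg _) (by positivity)
  have : |t - D₀ - s| ≤ D₀ := by rw [abs_le]; constructor <;> linarith [hs.1, hs.2]
  gcongr

/-- The gain of `forcedPredictor` with respect to a norm with weight `e^{-γ t}`. -/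
noncomputable def forcedGain (lam : ℕ → ℝ) (N : ℕ) (D₀ γ : ℝ) : ℝ :=
  N / (γ - ‖diagOp lam N‖) + Real.exp (‖diagOp lam N‖ * D₀) / γ

theorem forcedGain_nonneg (lam : ℕ → ℝ) (N : ℕ) (D₀ : ℝ) {γ : ℝ} (hγ : ‖diagOp lam N‖ < γ) :
    0 ≤ forcedGain lam N D₀ γ := by
  have h1 : 0 < γ := (norm_nonneg _).trans_lt hγ
  have h2 : 0 < γ - ‖diagOp lam N‖ := sub_pos.mpr hγ
  rw [forcedGain]
  positivity

/-- A large weight `γ` makes the feedback map a contraction without any smallness of `K` or of the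
delay. -/
theorem tendsto_forcedGain (lam : ℕ → ℝ) (N : ℕ) (D₀ : ℝ) :
    Tendsto (forcedGain lam N D₀) atTop (𝓝 0) := by
  have h1 : Tendsto (fun γ : ℝ => γ - ‖diagOp lam N‖) atTop atTop :=
    tendsto_atTop_add_const_right _ _ tendsto_id
  simpa using! (h1.const_div_atTop (N : ℝ)).add
    (tendsto_id.const_div_atTop (Real.exp (‖diagOp lam N‖ * D₀)))

theorem IsDelayedInput.norm_forcedPredictor_le (hV : IsDelayedInput e D₀ δ V) (hD₀ : 0 ≤ D₀)
    (hδ : δ ≤ D₀) (hw : Continuous w) {γ B t : ℝ} (hγ : ‖diagOp lam N‖ < γ) (hB : 0 ≤ B)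
    (ht : 0 ≤ t) (h : ∀ s ≤ t, ‖w s‖ ≤ B * Real.exp (γ * s)) :
    ‖forcedPredictor e lam D₀ V w t‖ ≤ forcedGain lam N D₀ γ * B * Real.exp (γ * t) := by
  have hγ0 : 0 < γ := (norm_nonneg _).trans_lt hγ
  set a := ‖diagOp lam N‖ with ha
  have h1 := norm_intervalIntegral_le_exp
    (f := fun s => expFlow (diagOp lam N) (t - s) (delayedModes e V w s))
    (C := N * B * Real.exp (a * t)) (r := γ - a) ht (sub_pos.mpr hγ) (by positivity) (by
      intro s hs
      refine (ContinuousLinearMap.le_opNorm _ _).trans ?_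
      have h2 := (norm_modesL_le e N (V w s)).trans
        (hV.norm_le_exp hδ hw hγ0.le hB hs.1 fun r hr => h r (hr.trans hs.2))
      rw [delayedModes, max_eq_left hs.1]
      refine (mul_le_mul (norm_expFlow_le _ _) h2 (norm_nonneg _) (by positivity)).trans
        (le_of_eq ?_)
      rw [abs_of_nonneg (sub_nonneg.mpr hs.2), ← ha, mul_left_comm, mul_assoc _ (Real.exp (a * t)),
        ← Real.exp_add, ← Real.exp_add]
      ring_nf)
  have h2 := norm_historyIntegral_le (lam := lam) hD₀ hγ0 hB h
  refine (norm_add_le _ _).trans ((add_le_add h1 h2).trans (le_of_eq ?_))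
  rw [forcedGain, ← ha, div_mul_eq_mul_div _ (γ - a), mul_assoc _ (Real.exp (a * t)),
    ← Real.exp_add, show a * t + (γ - a) * t = γ * t by ring]
  ring

end Predictor

/-! ### The fixed point equation for the control signal -/

section FixedPoint

variable {H : Type*} [NormedAddCommGroup H] [InnerProductSpace ℝ H]
  {e : HilbertBasis ℕ ℝ H} {lam : ℕ → ℝ} {N : ℕ} {D₀ δ γ : ℝ}
  {V : (ℝ → EuclideanSpace ℝ (Fin N)) → ℝ → H} {φ : ℝ → ℝ} {t₀ : ℝ}
  {K : EuclideanSpace ℝ (Fin N) →L[ℝ] EuclideanSpace ℝ (Fin N)}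

theorem IsTransitionSignal.norm_smul_le (hφ : IsTransitionSignal φ t₀) {E : Type*}
    [NormedAddCommGroup E] [NormedSpace ℝ E] (t : ℝ) (x : E) : ‖φ t • x‖ ≤ ‖x‖ := by
  rw [norm_smul, Real.norm_of_nonneg (hφ.mem_Icc t).1]
  exact mul_le_of_le_one_left (norm_nonneg _) (hφ.mem_Icc t).2

/-- The difference of the feedback laws of two control signals. -/
theorem IsDelayedInput.norm_feedback_sub_le (hV : IsDelayedInput e D₀ δ V) (hD₀ : 0 ≤ D₀)
    (hδ : δ ≤ D₀) (hφ : IsTransitionSignal φ t₀) (hγ : ‖diagOp lam N‖ < γ)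
    (hgain : ‖K‖ * forcedGain lam N D₀ γ ≤ 1 / 2) (x₀ : EuclideanSpace ℝ (Fin N))
    {w w' : ℝ → EuclideanSpace ℝ (Fin N)} (hw : Continuous w) (hw' : Continuous w') {B t : ℝ}
    (hB : 0 ≤ B) (h : ∀ s ≤ t, ‖w s - w' s‖ ≤ B * Real.exp (γ * s)) :
    ‖φ t • K (predictorState e lam D₀ V x₀ w t) - φ t • K (predictorState e lam D₀ V x₀ w' t)‖
      ≤ 1 / 2 * B * Real.exp (γ * t) := by
  -- At nonpositive times `φ` vanishes, so the values of the predictor state there do not matter.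
  rcases le_total t 0 with ht | ht
  · rw [hφ.eq_zero t ht]
    simp only [zero_smul, sub_zero, norm_zero]
    positivity
  · rw [← smul_sub, ← map_sub]
    refine (hφ.norm_smul_le t _).trans ((K.le_opNorm _).trans ?_)
    have h1 : predictorState e lam D₀ V x₀ w t - predictorState e lam D₀ V x₀ w' t
        = forcedPredictor e lam D₀ V (fun s => w s - w' s) t := by
      rw [hV.forcedPredictor_sub hw hw', predictorState, predictorState]
      abel
    rw [h1]
    have h2 := hV.norm_forcedPredictor_le hD₀ hδ (hw.sub hw') hγ hB ht h
    refine (mul_le_mul_of_nonneg_left h2 (norm_nonneg K)).trans ?_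
    rw [← mul_assoc, ← mul_assoc]
    gcongr

/-- Uniqueness of the control signal. -/
theorem IsDelayedInput.fixedPoint_unique (hV : IsDelayedInput e D₀ δ V) (hD₀ : 0 ≤ D₀)
    (hδ : δ ≤ D₀) (hφ : IsTransitionSignal φ t₀) (hγ : ‖diagOp lam N‖ < γ)
    (hgain : ‖K‖ * forcedGain lam N D₀ γ ≤ 1 / 2) {x₀ : EuclideanSpace ℝ (Fin N)}
    {w w' : ℝ → EuclideanSpace ℝ (Fin N)} (hw : Continuous w) (hw' : Continuous w')
    (h : ∀ t, w t = φ t • K (predictorState e lam D₀ V x₀ w t))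
    (h' : ∀ t, w' t = φ t • K (predictorState e lam D₀ V x₀ w' t)) : w = w' := by
  funext t
  have hneg : ∀ s ≤ 0, w s - w' s = 0 := by
    intro s hs
    rw [h, h', hφ.eq_zero s hs]
    simp
  rcases le_total t 0 with ht | ht
  · exact sub_eq_zero.mp (hneg t ht)
  · have hcont : Continuous fun s => ‖w s - w' s‖ * Real.exp (-(γ * s)) :=
      (hw.sub hw').norm.mul (by fun_prop)
    -- The maximum `B` of the weighted difference on `[0, t]` satisfies `B ≤ B / 2`, hence is 0.
    obtain ⟨r, hr, hmax⟩ := isCompact_Icc.exists_isMaxOn ⟨0, left_mem_Icc.mpr ht⟩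
      hcont.continuousOn
    set B := ‖w r - w' r‖ * Real.exp (-(γ * r)) with hB
    have hexp : ∀ s, Real.exp (-(γ * s)) * Real.exp (γ * s) = 1 := fun s => by
      rw [← Real.exp_add]; simp
    have hB0 : 0 ≤ B := by positivity
    have hbound : ∀ s ≤ t, ‖w s - w' s‖ ≤ B * Real.exp (γ * s) := by
      intro s hs
      rcases le_total s 0 with hs0 | hs0
      · rw [hneg s hs0, norm_zero]
        positivity
      · have h1 : ‖w s - w' s‖ * Real.exp (-(γ * s)) ≤ B := hmax ⟨hs0, hs⟩
        have h2 := mul_le_mul_of_nonneg_right h1 (Real.exp_pos (γ * s)).le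
        rwa [mul_assoc, hexp, mul_one] at h2
    have h3 := hV.norm_feedback_sub_le hD₀ hδ hφ hγ hgain x₀ hw hw' hB0
      fun s hs => hbound s (hs.trans hr.2)
    rw [← h, ← h'] at h3
    have h4 := mul_le_mul_of_nonneg_right h3 (Real.exp_pos (-(γ * r))).le
    rw [← hB, mul_assoc, mul_comm (Real.exp (γ * r)), hexp] at h4
    have h5 : B = 0 := by linarith
    have h6 := hbound t le_rfl
    rw [h5, zero_mul, norm_le_zero_iff] at h6
    exact sub_eq_zero.mp h6

/-- Existence of the control signal, with an exponential bound. -/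
theorem IsDelayedInput.exists_fixedPoint (hV : IsDelayedInput e D₀ δ V) (hD₀ : 0 ≤ D₀)
    (hδ : δ ≤ D₀) (hφ : IsTransitionSignal φ t₀) (hγ : ‖diagOp lam N‖ < γ)
    (hgain : ‖K‖ * forcedGain lam N D₀ γ ≤ 1 / 2) (x₀ : EuclideanSpace ℝ (Fin N)) :
    ∃ w : ℝ → EuclideanSpace ℝ (Fin N), Continuous w ∧
      (∀ t, w t = φ t • K (predictorState e lam D₀ V x₀ w t)) ∧
      ∀ t, ‖w t‖ ≤ 2 * ‖K‖ * ‖x₀‖ * Real.exp (γ * t) := by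
  have hexp : ∀ s, Real.exp (-(γ * s)) * Real.exp (γ * s) = 1 := fun s => by
    rw [← Real.exp_add]; simp
  -- The unknown is `z(t) = e^{-γt} w(t)`, so the exponentially weighted norm of `w` is the sup norm
  -- of `z`, and `F` is the feedback law in these coordinates.
  let W : BoundedContinuousFunction ℝ (EuclideanSpace ℝ (Fin N)) → ℝ →
    EuclideanSpace ℝ (Fin N) := fun z t => Real.exp (γ * t) • z t
  have hW : ∀ z, Continuous (W z) := fun z =>
    (by fun_prop : Continuous fun t => Real.exp (γ * t)).smul z.continuous
  let F : (ℝ → EuclideanSpace ℝ (Fin N)) → ℝ → EuclideanSpace ℝ (Fin N) := fun w t =>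
    Real.exp (-(γ * t)) • φ t • K (predictorState e lam D₀ V x₀ w t)
  have hFc : ∀ {w}, Continuous w → Continuous (F w) := fun hw =>
    (by fun_prop : Continuous fun t => Real.exp (-(γ * t))).smul
      (hφ.continuous.smul (K.continuous.comp (hV.continuous_predictorState hw x₀)))
  have hFsub : ∀ {w w'}, Continuous w → Continuous w' → ∀ {B}, 0 ≤ B →
      (∀ s, ‖w s - w' s‖ ≤ B * Real.exp (γ * s)) → ∀ t, ‖F w t - F w' t‖ ≤ 1 / 2 * B := by
    intro w w' hw hw' B hB hb t
    have h1 := hV.norm_feedback_sub_le hD₀ hδ hφ hγ hgain x₀ hw hw' (t := t) hB fun s _ => hb s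
    simp only [F]
    rw [← smul_sub, norm_smul, Real.norm_of_nonneg (Real.exp_pos _).le]
    refine (mul_le_mul_of_nonneg_left h1 (Real.exp_pos _).le).trans (le_of_eq ?_)
    rw [mul_left_comm, hexp, mul_one]
  have hV0 : ∀ t, 0 ≤ t → V (fun _ => 0) t = 0 := fun t ht => by
    rw [hV.const 0 ht]; simp [synthesis]
  have hF0 : ∀ t, ‖F (fun _ => 0) t‖ ≤ ‖K‖ * ‖x₀‖ := by
    intro t
    simp only [F]
    rcases le_total t 0 with ht | ht
    · rw [hφ.eq_zero t ht]
      simp only [zero_smul, smul_zero, norm_zero]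
      positivity
    · have h1 : predictorState e lam D₀ V x₀ (fun _ => 0) t = expFlow (diagOp lam N) t x₀ := by
        simp [predictorState, forcedPredictor, historyIntegral, delayedModes,
          hV0 _ (le_max_right _ _)]
      rw [h1, norm_smul, Real.norm_of_nonneg (Real.exp_pos _).le]
      have h2 : ‖φ t • K (expFlow (diagOp lam N) t x₀)‖ ≤ ‖K‖ * ‖x₀‖ * Real.exp (γ * t) := by
        refine (hφ.norm_smul_le t _).trans ((K.le_opNorm _).trans ?_)
        rw [mul_assoc]
        refine mul_le_mul_of_nonneg_left ?_ (norm_nonneg K)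
        refine (ContinuousLinearMap.le_opNorm _ _).trans ?_
        rw [mul_comm]
        refine mul_le_mul_of_nonneg_left ((norm_expFlow_le _ _).trans ?_) (norm_nonneg _)
        rw [abs_of_nonneg ht]
        gcongr
      refine (mul_le_mul_of_nonneg_left h2 (Real.exp_pos _).le).trans (le_of_eq ?_)
      rw [mul_left_comm, hexp, mul_one]
  have hWb : ∀ z s, ‖W z s - (fun _ => 0) s‖ ≤ ‖z‖ * Real.exp (γ * s) := by
    intro z s
    simp only [W, sub_zero]
    rw [norm_smul, Real.norm_of_nonneg (Real.exp_pos _).le, mul_comm]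
    gcongr
    exact z.norm_coe_le_norm s
  have hFb : ∀ z t, ‖F (W z) t‖ ≤ 1 / 2 * ‖z‖ + ‖K‖ * ‖x₀‖ := by
    intro z t
    have h1 := hFsub (hW z) continuous_const (norm_nonneg z) (hWb z) t
    have h2 := norm_add_le (F (W z) t - F (fun _ => 0) t) (F (fun _ => 0) t)
    rw [sub_add_cancel] at h2
    linarith [hF0 t]
  let Φ : BoundedContinuousFunction ℝ (EuclideanSpace ℝ (Fin N)) →
      BoundedContinuousFunction ℝ (EuclideanSpace ℝ (Fin N)) := fun z =>
    BoundedContinuousFunction.ofNormedAddCommGroup (F (W z)) (hFc (hW z)) _ (hFb z)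
  have hcontr : ContractingWith (1 / 2) Φ := by
    refine ⟨by norm_num, LipschitzWith.of_dist_le_mul fun z z' => ?_⟩
    rw [BoundedContinuousFunction.dist_le (by positivity)]
    intro t
    rw [dist_eq_norm]
    refine (hFsub (hW z) (hW z') (dist_nonneg (x := z) (y := z')) (fun s => ?_) t).trans
      (le_of_eq (by simp))
    simp only [W]
    rw [← smul_sub, norm_smul, Real.norm_of_nonneg (Real.exp_pos _).le, mul_comm]
    gcongr
    rw [← dist_eq_norm]
    exact z.dist_coe_le_dist s
  set z := hcontr.fixedPoint with hz
  have hfix : ∀ t, F (W z) t = z t := fun t =>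
    congrArg (fun g : BoundedContinuousFunction ℝ (EuclideanSpace ℝ (Fin N)) => g t)
      hcontr.fixedPoint_isFixedPt
  refine ⟨W z, hW z, fun t => ?_, fun t => ?_⟩
  · simp only [W]
    rw [← hfix t]
    simp only [F]
    rw [smul_smul, mul_comm, hexp, one_smul]
  -- Solving this inequality for `‖z‖` gives the factor 2 in the growth bound.
  · have hzn : ‖z‖ ≤ 1 / 2 * ‖z‖ + ‖K‖ * ‖x₀‖ := by
      rw [BoundedContinuousFunction.norm_le (by positivity)]
      intro t
      rw [← hfix t]
      exact hFb z t
    have h1 := hWb z t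
    rw [sub_zero] at h1
    refine h1.trans ?_
    gcongr
    linarith

end FixedPoint

/-! ### A small-gain estimate -/

section SmallGain

variable {E : Type*} [NormedAddCommGroup E] [NormedSpace ℝ E] [CompleteSpace E]

/-- The loop gain of the delay perturbation for functions that decay at the rate `κ`. -/
noncomputable def loopGain (a M σ D₀ δ k κ : ℝ) : ℝ :=
  k * Real.exp (κ * (D₀ + δ)) * M * ((Real.exp (a * δ) - 1) / (σ - κ) + δ)

theorem continuousAt_loopGain (a M D₀ δ k : ℝ) {σ : ℝ} (hσ : 0 < σ) :
    ContinuousAt (loopGain a M σ D₀ δ k) 0 := by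
  unfold loopGain
  have : σ - 0 ≠ 0 := by simpa using hσ.ne'
  fun_prop (disch := assumption)

/-- Decay of a solution of `z' = L z + Δ` with `L` exponentially stable and `Δ` bounded by the
oscillation of `z` over a past window. -/
theorem exists_norm_le_of_loopGain_lt_one {L : E →L[ℝ] E} {M σ D₀ δ t₀ k κ : ℝ} (hM : 0 ≤ M)
    (hL : ∀ t, 0 ≤ t → ‖expFlow L t‖ ≤ M * Real.exp (-σ * t)) (hδ : 0 ≤ δ) (hδD : δ ≤ D₀)
    (hk : 0 ≤ k) (hκ : 0 < κ) (hκσ : κ < σ) (hgain : loopGain ‖L‖ M σ D₀ δ k κ < 1) :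
    ∃ C : ℝ, 0 ≤ C ∧ ∀ (z Δ : ℝ → E) (B : ℝ), 0 ≤ B → Continuous Δ →
      (∀ t, t₀ ≤ t → HasDerivAt z (L (z t) + Δ t) t) → ‖z t₀‖ ≤ B →
      (∀ t ∈ Icc t₀ (t₀ + D₀ + δ), ‖Δ t‖ ≤ B) →
      (∀ t, t₀ + D₀ + δ ≤ t → ∀ b, (∀ τ, |τ - D₀| ≤ δ → ‖z (t - τ) - z (t - D₀)‖ ≤ b) →
        ‖Δ t‖ ≤ k * b) →
      ∀ t, t₀ ≤ t → ‖z t‖ ≤ C * B * Real.exp (-κ * t) := by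
  set q := loopGain ‖L‖ M σ D₀ δ k κ with hq
  have hq1 : 0 < 1 - q := by linarith
  have hσκ : 0 < σ - κ := by linarith
  set g := Real.exp (‖L‖ * δ) - 1 with hg
  have hg0 : 0 ≤ g := by
    have := Real.one_le_exp (mul_nonneg (norm_nonneg L) hδ)
    linarith
  set t₁ := t₀ + D₀ + δ with ht₁
  -- `c` carries the effect of `z t₀` on the oscillation, and `C₁` solves `S ≤ (e^{κt₁} + c) B + q
  -- S` for `S`. From `t₁` on, the whole delay window lies in `[t₀, ∞)`.
  set c := k * Real.exp (κ * (D₀ + δ)) * g * M * Real.exp (κ * t₀) with hc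
  set C₁ := (Real.exp (κ * t₁) + c) / (1 - q) with hC₁
  have hc0 : 0 ≤ c := by positivity
  have hC₁0 : 0 ≤ C₁ := by positivity
  refine ⟨M * Real.exp (κ * t₀) + M * C₁ / (σ - κ), by positivity, ?_⟩
  intro z Δ B hB hΔc hz hz₀ hΔ₀ hΔ
  have hvc : ∀ {a b}, t₀ ≤ a → a ≤ b →
      z b = expFlow L (b - a) (z a) + ∫ s in a..b, expFlow L (b - s) (Δ s) := fun ha hab =>
    eq_expFlow_add_integral L hΔc hab fun t ht => hz t (ha.trans ht.1)
  have hzb : ∀ {T S}, 0 ≤ S → (∀ r ∈ Icc t₀ T, ‖Δ r‖ ≤ S * Real.exp (-κ * r)) →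
      ∀ t ∈ Icc t₀ T, ‖z t‖ ≤ (M * B * Real.exp (κ * t₀) + M * S / (σ - κ)) *
        Real.exp (-κ * t) := by
    intro T S hS hb t ht
    rw [hvc le_rfl ht.1, add_mul]
    refine (norm_add_le _ _).trans (add_le_add ?_ ?_)
    · refine (ContinuousLinearMap.le_opNorm _ _).trans ?_
      refine (mul_le_mul (hL _ (sub_nonneg.mpr ht.1)) hz₀ (norm_nonneg _)
        (by positivity)).trans ?_
      have : Real.exp (-σ * (t - t₀)) ≤ Real.exp (κ * t₀) * Real.exp (-κ * t) := by
        rw [← Real.exp_add, Real.exp_le_exp]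
        nlinarith [mul_nonneg hσκ.le (sub_nonneg.mpr ht.1)]
      calc M * Real.exp (-σ * (t - t₀)) * B = M * B * Real.exp (-σ * (t - t₀)) := by ring
        _ ≤ M * B * (Real.exp (κ * t₀) * Real.exp (-κ * t)) := by gcongr
        _ = _ := by ring
    · have h1 := norm_intervalIntegral_le_exp (f := fun s => expFlow L (t - s) (Δ s))
        (C := M * S * Real.exp (-σ * t)) (r := σ - κ) ht.1 hσκ (by positivity) (by
          intro s hs
          refine (ContinuousLinearMap.le_opNorm _ _).trans ?_
          refine (mul_le_mul (hL _ (sub_nonneg.mpr hs.2)) (hb s ⟨hs.1, hs.2.trans ht.2⟩)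
            (norm_nonneg _) (by positivity)).trans (le_of_eq ?_)
          rw [show M * Real.exp (-σ * (t - s)) * (S * Real.exp (-κ * s))
            = M * S * (Real.exp (-σ * (t - s)) * Real.exp (-κ * s)) by ring, mul_assoc (M * S),
            ← Real.exp_add, ← Real.exp_add]
          ring_nf)
      refine h1.trans (le_of_eq ?_)
      rw [div_mul_eq_mul_div, mul_assoc, ← Real.exp_add, div_mul_eq_mul_div]
      ring_nf
  have hosc : ∀ {T S}, 0 ≤ S → (∀ r ∈ Icc t₀ T, ‖Δ r‖ ≤ S * Real.exp (-κ * r)) →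
      ∀ {a b}, t₀ ≤ a → a ≤ b → b ≤ T → b - a ≤ δ →
      ‖z b - z a‖ ≤ (g * (M * B * Real.exp (κ * t₀) + M * S / (σ - κ)) + M * S * δ) *
        Real.exp (-κ * a) := by
    -- Restarted at `a`, variation of constants gives two terms: `e^{(b-a)L} - 1` has norm at most
    -- `g`, and the integral runs over a length of at most `δ`.
    intro T S hS hb a b ha hab hbT hba
    have h0 : z b - z a = (expFlow L (b - a) - 1) (z a) + ∫ s in a..b, expFlow L (b - s) (Δ s) := by
      conv_lhs => rw [hvc ha hab]
      rw [sub_apply, one_apply_eq_self]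
      abel
    rw [h0, add_mul]
    refine (norm_add_le _ _).trans (add_le_add ?_ ?_)
    · rw [mul_assoc]
      refine (ContinuousLinearMap.le_opNorm _ _).trans ?_
      refine mul_le_mul ((norm_expFlow_sub_one_le L _).trans ?_)
        (hzb hS hb a ⟨ha, hab.trans hbT⟩) (norm_nonneg _) hg0
      rw [abs_of_nonneg (sub_nonneg.mpr hab), hg]
      gcongr
    · have h1 := intervalIntegral.norm_integral_le_of_norm_le_const (a := a) (b := b)
        (f := fun s => expFlow L (b - s) (Δ s)) (C := M * S * Real.exp (-κ * a)) (by
          intro s hs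
          rw [uIoc_of_le hab] at hs
          refine (ContinuousLinearMap.le_opNorm _ _).trans ?_
          rw [mul_assoc]
          refine mul_le_mul ((hL _ (sub_nonneg.mpr hs.2)).trans ?_)
            ((hb s ⟨ha.trans hs.1.le, hs.2.trans hbT⟩).trans ?_) (norm_nonneg _) hM
          · refine mul_le_of_le_one_right hM (Real.exp_le_one_iff.mpr ?_)
            nlinarith [mul_nonneg (hκ.trans hκσ).le (sub_nonneg.mpr hs.2)]
          · gcongr 1
            rw [Real.exp_le_exp]
            nlinarith [mul_nonneg hκ.le (sub_nonneg.mpr hs.1.le)])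
      refine h1.trans ?_
      rw [abs_of_nonneg (sub_nonneg.mpr hab)]
      calc M * S * Real.exp (-κ * a) * (b - a) ≤ M * S * Real.exp (-κ * a) * δ := by gcongr
        _ = _ := by ring
  have hexp : ∀ s, Real.exp (κ * s) * Real.exp (-κ * s) = 1 := fun s => by
    rw [← Real.exp_add]; simp
  -- Small gain: on a compact interval the maximum `S` of `e^{κs}‖Δ s‖` is finite, and inserting the
  -- oscillation bound returns at most `q S` plus data. As `q < 1`, the bound on `S` does not depend
  -- on the interval.
  have hΔdecay : ∀ t, t₀ ≤ t → ∀ r ∈ Icc t₀ t, ‖Δ r‖ ≤ C₁ * B * Real.exp (-κ * r) := by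
    intro T hT
    have hcont : Continuous fun s => Real.exp (κ * s) * ‖Δ s‖ := by fun_prop
    obtain ⟨r, hr, hmax⟩ := isCompact_Icc.exists_isMaxOn ⟨t₀, left_mem_Icc.mpr hT⟩
      hcont.continuousOn
    set S := Real.exp (κ * r) * ‖Δ r‖ with hS
    have hS0 : 0 ≤ S := by positivity
    have hb : ∀ s ∈ Icc t₀ T, ‖Δ s‖ ≤ S * Real.exp (-κ * s) := by
      intro s hs
      have h1 : Real.exp (κ * s) * ‖Δ s‖ ≤ S := hmax hs
      have h2 := mul_le_mul_of_nonneg_right h1 (Real.exp_pos (-κ * s)).le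
      rwa [mul_right_comm, hexp, one_mul] at h2
    have hSle : S ≤ Real.exp (κ * t₁) * B + c * B + q * S := by
      have hqS : 0 ≤ q * S := by
        rw [hq, loopGain]
        positivity
      rcases le_total r t₁ with h | h
      · have : S ≤ Real.exp (κ * t₁) * B := by
          rw [hS]
          exact mul_le_mul (by gcongr) (hΔ₀ r ⟨hr.1, h⟩) (norm_nonneg _) (Real.exp_pos _).le
        nlinarith [mul_nonneg hc0 hB]
      · have h1 := hΔ r h ((g * (M * B * Real.exp (κ * t₀) + M * S / (σ - κ)) + M * S * δ) *
          Real.exp (-κ * (r - D₀ - δ))) (by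
            intro τ hτ
            have hτ' := abs_le.mp hτ
            have hpos : 0 ≤ g * (M * B * Real.exp (κ * t₀) + M * S / (σ - κ)) + M * S * δ := by
              positivity
            -- The oscillation bound starts from the earlier of the two times, which is at least `r
            -- - D₀ - δ`; this produces the factor `e^{κ(D₀+δ)}` of `loopGain`.
            rcases le_total τ D₀ with h2 | h2
            · refine (hosc hS0 hb (a := r - D₀) (b := r - τ) (by linarith) (by linarith)
                (by linarith [hr.2]) (by linarith)).trans ?_
              refine mul_le_mul_of_nonneg_left (Real.exp_le_exp.mpr ?_) hpos
              nlinarith [mul_nonneg hκ.le hδ]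
            · rw [norm_sub_rev]
              refine (hosc hS0 hb (a := r - τ) (b := r - D₀) (by linarith) (by linarith)
                (by linarith [hr.2]) (by linarith)).trans ?_
              refine mul_le_mul_of_nonneg_left (Real.exp_le_exp.mpr ?_) hpos
              nlinarith [mul_nonneg hκ.le (show 0 ≤ D₀ + δ - τ by linarith)])
        have h2 := mul_le_mul_of_nonneg_left h1 (Real.exp_pos (κ * r)).le
        rw [← hS] at h2
        have h3 : Real.exp (κ * r) * (k * ((g * (M * B * Real.exp (κ * t₀) + M * S / (σ - κ))
            + M * S * δ) * Real.exp (-κ * (r - D₀ - δ)))) = c * B + q * S := by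
          have h4 : Real.exp (κ * r) * Real.exp (-κ * (r - D₀ - δ)) = Real.exp (κ * (D₀ + δ)) := by
            rw [← Real.exp_add]; ring_nf
          rw [hc, hq, loopGain, ← h4, ← hg]
          ring
        rw [h3] at h2
        have : 0 ≤ Real.exp (κ * t₁) * B := by positivity
        linarith
    have hSC : S ≤ C₁ * B := by
      rw [hC₁, div_mul_eq_mul_div, le_div_iff₀ hq1]
      linarith
    exact fun s hs => (hb s hs).trans (by gcongr)
  intro t ht
  refine (hzb (by positivity) (hΔdecay t ht) t ⟨ht, le_rfl⟩).trans (le_of_eq ?_)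
  ring

end SmallGain

/-! ### Decay of the closed loop -/

section Decay

variable {H : Type*} [NormedAddCommGroup H] [InnerProductSpace ℝ H]
  {e : HilbertBasis ℕ ℝ H} {lam : ℕ → ℝ} {N : ℕ} {D₀ δ γ : ℝ}
  {V : (ℝ → EuclideanSpace ℝ (Fin N)) → ℝ → H} {φ : ℝ → ℝ} {t₀ : ℝ}
  {K : EuclideanSpace ℝ (Fin N) →L[ℝ] EuclideanSpace ℝ (Fin N)}

theorem IsDelayedInput.norm_predictorState_le (hV : IsDelayedInput e D₀ δ V) (hD₀ : 0 ≤ D₀)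
    (hδ : δ ≤ D₀) (hγ : ‖diagOp lam N‖ < γ) {x₀ : EuclideanSpace ℝ (Fin N)}
    {w : ℝ → EuclideanSpace ℝ (Fin N)} (hw : Continuous w) {B t : ℝ} (hB : 0 ≤ B) (ht : 0 ≤ t)
    (h : ∀ s, ‖w s‖ ≤ B * Real.exp (γ * s)) :
    ‖predictorState e lam D₀ V x₀ w t‖
      ≤ (‖x₀‖ + forcedGain lam N D₀ γ * B) * Real.exp (γ * t) := by
  rw [predictorState, add_mul]
  refine (norm_add_le _ _).trans (add_le_add ?_
    (hV.norm_forcedPredictor_le hD₀ hδ hw hγ hB ht fun s _ => h s))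
  refine (ContinuousLinearMap.le_opNorm _ _).trans ?_
  rw [mul_comm]
  refine mul_le_mul_of_nonneg_left ((norm_expFlow_le _ _).trans ?_) (norm_nonneg _)
  rw [abs_of_nonneg ht]
  gcongr

/-- A constant signal passes unchanged through the delays, so subtracting `c` amounts to feeding `w
- c`. With `c = w(t - D₀)` only the oscillation of `w` remains. -/
theorem IsDelayedInput.delayedModes_sub (hV : IsDelayedInput e D₀ δ V)
    {w : ℝ → EuclideanSpace ℝ (Fin N)} (hw : Continuous w) {t : ℝ} (ht : 0 ≤ t)
    (c : EuclideanSpace ℝ (Fin N)) :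
    delayedModes e V w t - c = modesL e N (V (fun s => w s - c) t) := by
  rw [hV.sub hw continuous_const ht, hV.const c ht, map_sub, modesL_synthesis, delayedModes,
    max_eq_left ht]

/-- Exponential decay of the predictor state. -/
theorem exists_norm_predictorState_le (lam : ℕ → ℝ) (hD₀ : 0 ≤ D₀) (hδ : 0 ≤ δ) (hδD : δ ≤ D₀)
    (hγ : ‖diagOp lam N‖ < γ) (ht₀ : 0 ≤ t₀) (hφ : IsTransitionSignal φ t₀)
    {r : Fin N → ℝ} (hr : ∀ k, 0 ≤ r k) (hK : ∀ k x, |K x k| ≤ r k * ‖x‖)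
    {M σ κ : ℝ} (hM : 0 ≤ M) (hL : ∀ t, 0 ≤ t →
      ‖expFlow (diagOp lam N + expFlow (diagOp lam N) (-D₀) * K) t‖ ≤ M * Real.exp (-σ * t))
    (hκ : 0 < κ) (hκσ : κ < σ)
    (hgain : loopGain ‖diagOp lam N + expFlow (diagOp lam N) (-D₀) * K‖ M σ D₀ δ (∑ k, r k) κ < 1) :
    ∃ C : ℝ, 0 ≤ C ∧ ∀ (e : HilbertBasis ℕ ℝ H) (V : (ℝ → EuclideanSpace ℝ (Fin N)) → ℝ → H),
      IsDelayedInput e D₀ δ V →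
      ∀ (x₀ : EuclideanSpace ℝ (Fin N)) (w : ℝ → EuclideanSpace ℝ (Fin N)), Continuous w →
      (∀ t, w t = φ t • K (predictorState e lam D₀ V x₀ w t)) →
      (∀ t, ‖w t‖ ≤ 2 * ‖K‖ * ‖x₀‖ * Real.exp (γ * t)) →
      ∀ t, 0 ≤ t → ‖predictorState e lam D₀ V x₀ w t‖ ≤ C * ‖x₀‖ * Real.exp (-κ * t) := by
  obtain ⟨C, hC, hdecay⟩ := exists_norm_le_of_loopGain_lt_one (t₀ := t₀) hM hL hδ hδD
    (Finset.sum_nonneg fun k _ => hr k) hκ hκσ hgain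
  have hγ0 : 0 < γ := (norm_nonneg _).trans_lt hγ
  have hfg := forcedGain_nonneg lam N D₀ hγ
  set t₁ := t₀ + D₀ + δ with ht₁
  -- `b₁` bounds `z` on `[0, t₀]` and `b₂` bounds the perturbation on `[t₀, t₁]`, per unit of
  -- `‖x₀‖`. Both come from the growth bound on `w`, so they are uniform in the delay.
  set b₁ := (1 + forcedGain lam N D₀ γ * (2 * ‖K‖)) * Real.exp (γ * t₀) with hb₁
  set b₂ := (N + 1) * (2 * ‖K‖) * Real.exp (γ * t₁) with hb₂
  have hb₁0 : 0 ≤ b₁ := by positivity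
  have hb₂0 : 0 ≤ b₂ := by positivity
  refine ⟨b₁ * Real.exp (κ * t₀) + C * (b₁ + b₂), by positivity, ?_⟩
  intro e V hV x₀ w hw hfix hwb
  set z := predictorState e lam D₀ V x₀ w with hz
  set L := diagOp lam N + expFlow (diagOp lam N) (-D₀) * K
  have hz₀ : ∀ t, 0 ≤ t → t ≤ t₀ → ‖z t‖ ≤ b₁ * ‖x₀‖ := by
    intro t ht ht'
    refine (hV.norm_predictorState_le hD₀ hδD hγ hw (by positivity) ht hwb).trans ?_
    rw [hb₁, show (1 + forcedGain lam N D₀ γ * (2 * ‖K‖)) * Real.exp (γ * t₀) * ‖x₀‖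
      = (‖x₀‖ + forcedGain lam N D₀ γ * (2 * ‖K‖ * ‖x₀‖)) * Real.exp (γ * t₀) by ring]
    gcongr
  have hwz : ∀ t, t₀ ≤ t → w t = K (z t) := by
    intro t ht
    rw [hfix t, hφ.eq_one t ht, one_smul]
  have hderiv : ∀ t, t₀ ≤ t →
      HasDerivAt z (L (z t) + (delayedModes e V w t - w (t - D₀))) t := by
    intro t ht
    convert! hV.hasDerivAt_predictorState hw x₀ t using 1
    rw [hwz t ht, show L (z t) = diagOp lam N (z t) + expFlow (diagOp lam N) (-D₀) (K (z t))
      from rfl]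
    abel
  have hΔ₀ : ∀ t ∈ Icc t₀ t₁, ‖delayedModes e V w t - w (t - D₀)‖ ≤ (b₁ + b₂) * ‖x₀‖ := by
    intro t ht
    have h0 : 0 ≤ t := ht₀.trans ht.1
    have h1 := hV.norm_le_exp hδD hw hγ0.le (by positivity) h0 fun s _ => hwb s
    have h2 : ‖delayedModes e V w t‖ ≤ ‖V w t‖ := by
      rw [delayedModes, max_eq_left h0]
      exact norm_modesL_le e N _
    have h3 : Real.exp (γ * t) ≤ Real.exp (γ * t₁) := by
      gcongr
      exact ht.2
    have h4 : Real.exp (γ * (t - D₀)) ≤ Real.exp (γ * t₁) := by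
      gcongr
      linarith [ht.2]
    calc ‖delayedModes e V w t - w (t - D₀)‖
        ≤ N * (2 * ‖K‖ * ‖x₀‖) * Real.exp (γ * t) + 2 * ‖K‖ * ‖x₀‖ * Real.exp (γ * (t - D₀)) :=
          (norm_sub_le _ _).trans (add_le_add (h2.trans h1) (hwb _))
      _ ≤ N * (2 * ‖K‖ * ‖x₀‖) * Real.exp (γ * t₁) + 2 * ‖K‖ * ‖x₀‖ * Real.exp (γ * t₁) := by
          gcongr
      _ = b₂ * ‖x₀‖ := by rw [hb₂]; ring
      _ ≤ _ := by
          gcongr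
          linarith
  have hΔ : ∀ t, t₁ ≤ t → ∀ b, (∀ τ, |τ - D₀| ≤ δ → ‖z (t - τ) - z (t - D₀)‖ ≤ b) →
      ‖delayedModes e V w t - w (t - D₀)‖ ≤ (∑ k, r k) * b := by
    intro t ht b hb
    rw [hV.delayedModes_sub hw (by linarith)]
    refine (norm_modesL_le e N _).trans ?_
    rw [Finset.sum_mul]
    -- Coordinate `k` of the signal difference is row `k` of `K` applied to a difference of `z`,
    -- hence at most `r k * b`; the delayed input adds these bounds over `k`.
    refine hV.norm_le (hw.sub continuous_const) (by linarith) fun k τ hτ => ?_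
    have hτ' := abs_le.mp hτ
    change |(w (t - τ) - w (t - D₀)) k| ≤ r k * b
    rw [hwz (t - τ) (by linarith), hwz (t - D₀) (by linarith), ← map_sub]
    exact (hK k _).trans (mul_le_mul_of_nonneg_left (hb τ hτ) (hr k))
  intro t ht
  have hx := norm_nonneg x₀
  rcases le_total t t₀ with h | h
  · refine (hz₀ t ht h).trans ?_
    have h1 : 1 ≤ Real.exp (κ * t₀) * Real.exp (-κ * t) := by
      rw [← Real.exp_add]
      apply Real.one_le_exp
      nlinarith
    have h2 : b₁ * ‖x₀‖ ≤ b₁ * ‖x₀‖ * (Real.exp (κ * t₀) * Real.exp (-κ * t)) :=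
      le_mul_of_one_le_right (by positivity) h1
    have h3 : 0 ≤ C * (b₁ + b₂) * ‖x₀‖ * Real.exp (-κ * t) := by positivity
    linarith
  · have h1 := hdecay z (fun t => delayedModes e V w t - w (t - D₀)) ((b₁ + b₂) * ‖x₀‖)
      (by positivity) ((hV.continuous_delayedModes hw).sub (by fun_prop)) hderiv
      ((hz₀ t₀ ht₀ le_rfl).trans (by gcongr; linarith)) hΔ₀ hΔ t h
    have h3 : 0 ≤ b₁ * Real.exp (κ * t₀) * ‖x₀‖ * Real.exp (-κ * t) := by positivity
    linarith

variable [CompleteSpace H]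

/-- The predictor state of a mild solution. -/
theorem IsMildSolution.modesL_add_historyIntegral {T : ℝ → H →L[ℝ] H} (hC0 : IsC0Semigroup T)
    (hT : ∀ t, 0 ≤ t → ∀ n, T t (e n) = Real.exp (lam n * t) • e n) {X₀ : H}
    {w : ℝ → EuclideanSpace ℝ (Fin N)} {X : ℝ → H} (hX : IsMildSolution T X₀ (V w) X) {t : ℝ}
    (ht : 0 ≤ t) (D₀ : ℝ) : modesL e N (X t) + historyIntegral lam D₀ w t
      = predictorState e lam D₀ V (modesL e N X₀) w t := by
  rw [hX.modesL_eq hC0 hT ht, predictorState, forcedPredictor]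
  have : ∫ s in (0 : ℝ)..t, expFlow (diagOp lam N) (t - s) (modesL e N (V w s))
      = ∫ s in (0 : ℝ)..t, expFlow (diagOp lam N) (t - s) (delayedModes e V w s) := by
    refine intervalIntegral.integral_congr fun s hs => ?_
    rw [uIcc_of_le ht] at hs
    simp only [delayedModes, max_eq_left hs.1]
  rw [this, add_assoc]

/-- Exponential decay of the state and of the control signal. -/
theorem exists_norm_add_norm_le {T : ℝ → H →L[ℝ] H} (hC0 : IsC0Semigroup T)
    (hT : ∀ t, 0 ≤ t → ∀ n, T t (e n) = Real.exp (lam n * t) • e n) (hlam : Antitone lam)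
    (hD₀ : 0 ≤ D₀) (hδ : 0 ≤ δ) (hδD : δ ≤ D₀)
    (hγ : ‖diagOp lam N‖ < γ) (ht₀ : 0 ≤ t₀) (hφ : IsTransitionSignal φ t₀)
    {r : Fin N → ℝ} (hr : ∀ k, 0 ≤ r k) (hK : ∀ k x, |K x k| ≤ r k * ‖x‖)
    {M σ κ : ℝ} (hM : 0 ≤ M) (hL : ∀ t, 0 ≤ t →
      ‖expFlow (diagOp lam N + expFlow (diagOp lam N) (-D₀) * K) t‖ ≤ M * Real.exp (-σ * t))
    (hκ : 0 < κ) (hκσ : κ < σ) (hκN : κ < -lam N)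
    (hgain : loopGain ‖diagOp lam N + expFlow (diagOp lam N) (-D₀) * K‖ M σ D₀ δ (∑ k, r k) κ < 1) :
    ∃ C : ℝ, 0 ≤ C ∧ ∀ V : (ℝ → EuclideanSpace ℝ (Fin N)) → ℝ → H, IsDelayedInput e D₀ δ V →
      ∀ (X₀ : H) (w : ℝ → EuclideanSpace ℝ (Fin N)) (X : ℝ → H), Continuous w →
      (∀ t, w t = φ t • K (predictorState e lam D₀ V (modesL e N X₀) w t)) →
      (∀ t, ‖w t‖ ≤ 2 * ‖K‖ * ‖modesL e N X₀‖ * Real.exp (γ * t)) →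
      IsMildSolution T X₀ (V w) X →
      ∀ t, 0 ≤ t → ‖X t‖ + ‖w t‖ ≤ C * Real.exp (-κ * t) * ‖X₀‖ := by
  obtain ⟨C, hC, hpred⟩ := exists_norm_predictorState_le (H := H) lam hD₀ hδ hδD hγ ht₀ hφ hr hK
    hM hL hκ hκσ hgain
  set a := ‖diagOp lam N‖ with ha
  set C₁ := ‖K‖ * C with hC₁
  set C₂ := D₀ * Real.exp (a * D₀) * C₁ * Real.exp (κ * D₀) with hC₂
  set C₃ := N * C₁ * Real.exp (κ * (D₀ + δ)) with hC₃
  have hlN : 0 < -lam N - κ := by linarith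
  -- The summands account for the predictor state, the history integral, the tail and the control,
  -- in this order.
  refine ⟨C + C₂ + (1 + C₃ / (-lam N - κ)) + C₁, by positivity, ?_⟩
  intro V hV X₀ w X hw hfix hwb hX t ht
  set z := predictorState e lam D₀ V (modesL e N X₀) w with hz
  have hx₀ := norm_modesL_le e N X₀
  have hzb : ∀ s, 0 ≤ s → ‖z s‖ ≤ C * ‖X₀‖ * Real.exp (-κ * s) := by
    intro s hs
    refine (hpred e V hV _ w hw hfix hwb s hs).trans ?_
    gcongr
  have hwd : ∀ s, ‖w s‖ ≤ C₁ * ‖X₀‖ * Real.exp (-κ * s) := by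
    intro s
    rw [hfix s]
    rcases le_total s 0 with h | h
    · rw [hφ.eq_zero s h, zero_smul, norm_zero]
      positivity
    · refine (hφ.norm_smul_le s _).trans ((K.le_opNorm _).trans ?_)
      refine (mul_le_mul_of_nonneg_left (hzb s h) (norm_nonneg K)).trans (le_of_eq ?_)
      rw [hC₁]
      ring
  have hVd : ∀ s, 0 ≤ s → ‖V w s‖ ≤ C₃ * ‖X₀‖ * Real.exp (-κ * s) := by
    intro s hs
    have h1 := hV.norm_le hw hs
      (c := fun _ => C₁ * ‖X₀‖ * (Real.exp (κ * (D₀ + δ)) * Real.exp (-κ * s))) (by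
        intro k τ hτ
        refine (PiLp.norm_apply_le (w (s - τ)) k).trans ((hwd _).trans ?_)
        rw [← Real.exp_add]
        refine mul_le_mul_of_nonneg_left (Real.exp_le_exp.mpr ?_) (by positivity)
        have := mul_le_mul_of_nonneg_left (abs_le.mp hτ).2 hκ.le
        linarith)
    refine h1.trans (le_of_eq ?_)
    rw [Finset.sum_const, Finset.card_univ, Fintype.card_fin, nsmul_eq_mul, hC₃]
    ring
  have hhist : ‖historyIntegral lam D₀ w t‖ ≤ C₂ * ‖X₀‖ * Real.exp (-κ * t) := by
    have h1 := intervalIntegral.norm_integral_le_of_norm_le_const (a := t - D₀) (b := t)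
      (f := fun s => expFlow (diagOp lam N) (t - D₀ - s) (w s))
      (C := Real.exp (a * D₀) * (C₁ * ‖X₀‖ * (Real.exp (κ * D₀) * Real.exp (-κ * t)))) (by
        intro s hs
        rw [uIoc_of_le (by linarith)] at hs
        refine (ContinuousLinearMap.le_opNorm _ _).trans ?_
        refine mul_le_mul ((norm_expFlow_le _ _).trans ?_) ((hwd s).trans ?_) (norm_nonneg _)
          (Real.exp_pos _).le
        · have : |t - D₀ - s| ≤ D₀ := by rw [abs_le]; constructor <;> linarith [hs.1, hs.2]
          gcongr
        · rw [← Real.exp_add]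
          refine mul_le_mul_of_nonneg_left (Real.exp_le_exp.mpr ?_) (by positivity)
          have := mul_le_mul_of_nonneg_left hs.1.le hκ.le
          linarith)
    refine h1.trans (le_of_eq ?_)
    rw [show t - (t - D₀) = D₀ by ring, abs_of_nonneg hD₀, hC₂]
    ring
  -- Inverting the Artstein transform recovers the modes of the state from two decaying terms.
  have hmodes : modesL e N (X t) = z t - historyIntegral lam D₀ w t := by
    rw [hz, ← hX.modesL_add_historyIntegral hC0 hT ht D₀, add_sub_cancel_right]
  have htail := hX.norm_tailL_le hC0 hT hlam hκN (by positivity) hVd ht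
  have h1 := norm_le_modesL_add_tailL e (N := N) (X t)
  have h2 : ‖modesL e N (X t)‖ ≤ ‖z t‖ + ‖historyIntegral lam D₀ w t‖ := by
    rw [hmodes]
    exact norm_sub_le _ _
  have h3 := hzb t ht
  have h4 := hwd t
  calc ‖X t‖ + ‖w t‖ ≤ C * ‖X₀‖ * Real.exp (-κ * t) + C₂ * ‖X₀‖ * Real.exp (-κ * t)
        + (‖X₀‖ + C₃ * ‖X₀‖ / (-lam N - κ)) * Real.exp (-κ * t)
        + C₁ * ‖X₀‖ * Real.exp (-κ * t) := by linarith
    _ = _ := by ring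

end Decay

/-! ### The closed loop in terms of the control signal -/

section ClosedLoop

theorem IsMildSolution.congr_input {H : Type*} [NormedAddCommGroup H] [InnerProductSpace ℝ H]
    {T : ℝ → H →L[ℝ] H} {X₀ : H} {v v' X : ℝ → H} (h : IsMildSolution T X₀ v X)
    (hv : ∀ t, 0 ≤ t → v t = v' t) : IsMildSolution T X₀ v' X where
  continuousOn_input := h.continuousOn_input.congr fun t ht => (hv t ht).symm
  continuousOn := h.continuousOn
  eq t ht := by
    rw [h.eq t ht]
    congr 1
    refine intervalIntegral.integral_congr fun s hs => ?_
    rw [uIcc_of_le ht] at hs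
    simp only [hv s hs.1]

theorem abs_toEuclideanCLM_apply_le {N : ℕ} (K : Matrix (Fin N) (Fin N) ℝ) (k : Fin N)
    (x : EuclideanSpace ℝ (Fin N)) :
    |Matrix.toEuclideanCLM (𝕜 := ℝ) K x k| ≤ rowNorm K k * ‖x‖ := by
  have h := abs_real_inner_le_norm (WithLp.toLp 2 (K k) : EuclideanSpace ℝ (Fin N)) x
  refine le_of_eq_of_le ?_ h
  rw [Matrix.ofLp_toEuclideanCLM, PiLp.inner_apply, Matrix.mulVec, dotProduct]
  simp [mul_comm]

theorem toEuclideanCLM_closedLoopMatrix (lam : ℕ → ℝ) {N : ℕ} (D₀ : ℝ)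
    (K : Matrix (Fin N) (Fin N) ℝ) :
    Matrix.toEuclideanCLM (𝕜 := ℝ) (closedLoopMatrix lam D₀ K)
      = diagOp lam N + expFlow (diagOp lam N) (-D₀) * Matrix.toEuclideanCLM (𝕜 := ℝ) K := by
  rw [closedLoopMatrix, map_add, map_mul, toEuclideanCLM_exp]
  rfl

variable {ρ : ℝ → ℝ} {T : ℝ → WeightedL2 ρ →L[ℝ] WeightedL2 ρ} {lam : ℕ → ℝ}
  {e : HilbertBasis ℕ ℝ (WeightedL2 ρ)} {N : ℕ} {D₀ δ t₀ : ℝ} {K : Matrix (Fin N) (Fin N) ℝ}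
  {φ : ℝ → ℝ} {D : ℝ → ℝ → ℝ} {X₀ : WeightedL2 ρ}

theorem predictorFeedback_integral_eq (w : ℝ → EuclideanSpace ℝ (Fin N)) (t : ℝ) :
    ∫ s in (t - D₀)..t, Matrix.toEuclideanCLM (𝕜 := ℝ)
      (NormedSpace.exp ((t - D₀ - s) • diagMatrix lam N)) (w s) = historyIntegral lam D₀ w t := by
  simp only [toEuclideanCLM_exp]
  rfl

theorem IsClosedLoopSolution.input_eq {X v : ℝ → WeightedL2 ρ}
    {w : ℝ → EuclideanSpace ℝ (Fin N)} (h : IsClosedLoopSolution T lam e D₀ K φ D X₀ X v w)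
    (hD : IsAdmissibleDelay D₀ δ D) {t : ℝ} (ht : 0 ≤ t) : v t = delayedInput e D w t :=
  Lp.ext ((h.input t ht).trans (coeFn_delayedInput e hD h.feedback.continuous ht).symm)

/-- The control signal of a closed-loop solution satisfies the fixed point equation. -/
theorem IsClosedLoopSolution.fixedPoint {X v : ℝ → WeightedL2 ρ}
    {w : ℝ → EuclideanSpace ℝ (Fin N)} (h : IsClosedLoopSolution T lam e D₀ K φ D X₀ X v w)
    (hD : IsAdmissibleDelay D₀ δ D) (hφ : IsTransitionSignal φ t₀) (hC0 : IsC0Semigroup T)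
    (hT : ∀ t, 0 ≤ t → ∀ n, T t (e n) = Real.exp (lam n * t) • e n) (t : ℝ) :
    w t = φ t • Matrix.toEuclideanCLM (𝕜 := ℝ) K
      (predictorState e lam D₀ (delayedInput e D) (modesL e N X₀) w t) := by
  rcases lt_or_ge t 0 with ht | ht
  · rw [h.feedback.eq_zero t ht, hφ.eq_zero t ht.le, zero_smul]
  · have hX := h.mild.congr_input fun s hs => h.input_eq hD hs
    rw [h.feedback.eq t ht, predictorFeedback_integral_eq, ← modesL_eq,
      hX.modesL_add_historyIntegral hC0 hT ht]

/-- A solution of the fixed point equation gives a closed-loop solution. -/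
theorem isClosedLoopSolution_of_fixedPoint (hD : IsAdmissibleDelay D₀ δ D)
    (hφ : IsTransitionSignal φ t₀) (hC0 : IsC0Semigroup T)
    (hT : ∀ t, 0 ≤ t → ∀ n, T t (e n) = Real.exp (lam n * t) • e n)
    {w : ℝ → EuclideanSpace ℝ (Fin N)} (hw : Continuous w)
    (hfix : ∀ t, w t = φ t • Matrix.toEuclideanCLM (𝕜 := ℝ) K
      (predictorState e lam D₀ (delayedInput e D) (modesL e N X₀) w t)) :
    IsClosedLoopSolution T lam e D₀ K φ D X₀
      (fun t => T t X₀ + ∫ s in (0 : ℝ)..t, T (t - s) (delayedInput e D w s))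
      (delayedInput e D w) w := by
  have hvc := (hD.isDelayedInput e (N := N)).continuousOn hw
  have hmild : IsMildSolution T X₀ (delayedInput e D w)
      (fun t => T t X₀ + ∫ s in (0 : ℝ)..t, T (t - s) (delayedInput e D w s)) :=
    ⟨hvc, continuousOn_mildSolution hC0 hvc X₀, fun t _ => rfl⟩
  refine ⟨⟨hw, fun t ht => ?_, fun t ht => ?_⟩, fun t ht => coeFn_delayedInput e hD hw ht, hmild⟩
  · rw [hfix, hφ.eq_zero t ht.le, zero_smul]
  · rw [predictorFeedback_integral_eq, ← modesL_eq, hmild.modesL_add_historyIntegral hC0 hT ht]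
    exact hfix t

/-- At `κ = 0` the loop gain is `(M/σ) k (e^{aδ} - 1 + σδ)`. The factors `√N` and `e^{σδ}` and the
maximum with `e^{aδ}` only enlarge the left side of the hypothesis. -/
theorem loopGain_zero_lt_one {a M σ D₀ δ k : ℝ} (hN : 1 ≤ N) (ha : 0 ≤ a) (hM : 1 ≤ M)
    (hσ : 0 < σ) (hδ : 0 < δ) (hk : 0 ≤ k)
    (h : max M (Real.exp (a * δ)) * √(N : ℝ) / σ * k *
      ((Real.exp (a * δ) - 1) + σ * δ * Real.exp (σ * δ)) < 1) :
    loopGain a M σ D₀ δ k 0 < 1 := by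
  refine lt_of_le_of_lt ?_ h
  have h1 : 1 ≤ √(N : ℝ) := Real.one_le_sqrt.mpr (by exact_mod_cast hN)
  have h2 : 1 ≤ Real.exp (σ * δ) := Real.one_le_exp (by positivity)
  have h3 : 0 ≤ Real.exp (a * δ) - 1 := by
    linarith [Real.one_le_exp (mul_nonneg ha hδ.le)]
  have h4 : M ≤ max M (Real.exp (a * δ)) * √(N : ℝ) :=
    (le_max_left _ _).trans (le_mul_of_one_le_right (by positivity) h1)
  have h5 : σ * δ ≤ σ * δ * Real.exp (σ * δ) := le_mul_of_one_le_right (by positivity) h2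
  calc loopGain a M σ D₀ δ k 0
      = M / σ * k * ((Real.exp (a * δ) - 1) + σ * δ) := by
        rw [loopGain, zero_mul, Real.exp_zero, sub_zero]
        field_simp
    _ ≤ _ := by gcongr

end ClosedLoop

theorem theorem1
    -- the weighted space, the operator and its semigroup
    (ρ : ℝ → ℝ) (hρ_cont : ContinuousOn ρ (Icc 0 1)) (hρ_pos : ∀ ξ ∈ Icc (0 : ℝ) 1, 0 < ρ ξ)
    (A : WeightedL2 ρ →ₗ.[ℝ] WeightedL2 ρ) (hA : IsSelfAdjoint A)
    (hA_res : HasCompactResolvent A)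
    (T : ℝ → WeightedL2 ρ →L[ℝ] WeightedL2 ρ) (hT : IsC0Semigroup T)
    (hAT : IsGeneratorOf A T) :
    -- a sorted Hilbert basis of eigenvectors can be selected
    (∃ (lam : ℕ → ℝ) (e : HilbertBasis ℕ ℝ (WeightedL2 ρ)), IsSortedEigenbasis A lam e) ∧
    -- and the stability result holds for every such selection
    ∀ (lam : ℕ → ℝ) (e : HilbertBasis ℕ ℝ (WeightedL2 ρ)), IsSortedEigenbasis A lam e →
    ∀ N : ℕ, 1 ≤ N → lam N < 0 →
    ∀ D₀ : ℝ, 0 < D₀ →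
    ∀ K : Matrix (Fin N) (Fin N) ℝ, IsHurwitz (closedLoopMatrix lam D₀ K) →
    ∀ M σ : ℝ, 1 ≤ M → 0 < σ →
    (∀ t : ℝ, 0 ≤ t →
      matNorm (NormedSpace.exp (t • closedLoopMatrix lam D₀ K)) ≤ M * Real.exp (-σ * t)) →
    ∀ δ : ℝ, 0 < δ → δ < D₀ →
    max M (Real.exp (matNorm (closedLoopMatrix lam D₀ K) * δ)) * √(N : ℝ) / σ *
      (∑ k : Fin N, rowNorm K k) *
      ((Real.exp (matNorm (closedLoopMatrix lam D₀ K) * δ) - 1) + σ * δ * Real.exp (σ * δ)) < 1 →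
    ∀ (φ : ℝ → ℝ) (t₀ : ℝ), 0 < t₀ → IsTransitionSignal φ t₀ →
    ∃ κ C : ℝ, 0 < κ ∧ 0 < C ∧
      ∀ (X₀ : WeightedL2 ρ) (D : ℝ → ℝ → ℝ), IsAdmissibleDelay D₀ δ D →
        ∃ (X v : ℝ → WeightedL2 ρ) (w : ℝ → EuclideanSpace ℝ (Fin N)),
          IsClosedLoopSolution T lam e D₀ K φ D X₀ X v w ∧
          -- uniqueness
          (∀ (X' v' : ℝ → WeightedL2 ρ) (w' : ℝ → EuclideanSpace ℝ (Fin N)),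
            IsClosedLoopSolution T lam e D₀ K φ D X₀ X' v' w' →
              w' = w ∧ ∀ t, 0 ≤ t → X' t = X t ∧ v' t = v t) ∧
          -- exponential decay of the state and of the control input
          ∀ t : ℝ, 0 ≤ t → ‖X t‖ + ‖synthesis e (w t)‖ ≤ C * Real.exp (-κ * t) * ‖X₀‖ := by
  refine ⟨exists_isSortedEigenbasis (not_finiteDimensional_weightedL2 hρ_cont hρ_pos) hA hA_res
    hT hAT, ?_⟩
  intro lam e he N hN hlamN D₀ hD₀ K _ M σ hM hσ hexp δ hδ hδD hgain φ t₀ ht₀ hφ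
  have hTe : ∀ t, 0 ≤ t → ∀ n, T t (e n) = Real.exp (lam n * t) • e n := fun t ht n =>
    hT.apply_eigenvector hAT (he.mem_graph n) ht
  set K' := Matrix.toEuclideanCLM (𝕜 := ℝ) K with hK'
  set L := diagOp lam N + expFlow (diagOp lam N) (-D₀) * K' with hL
  have hcl : Matrix.toEuclideanCLM (𝕜 := ℝ) (closedLoopMatrix lam D₀ K) = L :=
    toEuclideanCLM_closedLoopMatrix lam D₀ K
  have hLexp : ∀ t, 0 ≤ t → ‖expFlow L t‖ ≤ M * Real.exp (-σ * t) := by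
    intro t ht
    have h := hexp t ht
    rwa [matNorm, toEuclideanCLM_exp, hcl] at h
  rw [matNorm, hcl] at hgain
  have hr : ∀ k, 0 ≤ rowNorm K k := fun k => norm_nonneg _
  have hgain0 : loopGain ‖L‖ M σ D₀ δ (∑ k, rowNorm K k) 0 < 1 :=
    loopGain_zero_lt_one hN (norm_nonneg L) hM hσ hδ (Finset.sum_nonneg fun k _ => hr k) hgain
  -- By continuity at 0 the loop gain stays below 1 for some positive rate, which can also be taken
  -- below `σ` and below `-lam N`, the decay rate of the tail.
  obtain ⟨κ, ⟨⟨hκg, hκσ⟩, hκN⟩, hκ⟩ := (((((continuousAt_loopGain ‖L‖ M D₀ δ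
    (∑ k, rowNorm K k) hσ).eventually_lt_const hgain0).and (eventually_lt_nhds hσ)).and
    (eventually_lt_nhds (neg_pos.mpr hlamN))).filter_mono
    (nhdsWithin_le_nhds (s := Ioi (0 : ℝ))) |>.and self_mem_nhdsWithin).exists
  have hlim : Tendsto (fun γ => ‖K'‖ * forcedGain lam N D₀ γ) atTop (𝓝 0) := by
    simpa using (tendsto_forcedGain lam N D₀).const_mul ‖K'‖
  obtain ⟨γ, hγg, hγ⟩ := ((hlim.eventually_le_const (by norm_num : (0 : ℝ) < 1 / 2)).and
    (eventually_gt_atTop ‖diagOp lam N‖)).exists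
  obtain ⟨C, hC, hdecay⟩ := exists_norm_add_norm_le hT hTe he.antitone hD₀.le hδ.le hδD.le hγ
    ht₀.le hφ hr (abs_toEuclideanCLM_apply_le K) (zero_le_one.trans hM) hLexp hκ hκσ hκN hκg
  -- `C` is only known to be nonnegative; adding 1 makes the constant positive.
  refine ⟨κ, C + 1, hκ, by linarith, fun X₀ D hD => ?_⟩
  have hV := hD.isDelayedInput e (N := N)
  obtain ⟨w, hw, hfix, hwb⟩ := hV.exists_fixedPoint hD₀.le hδD.le hφ hγ hγg (modesL e N X₀)
  have hsol := isClosedLoopSolution_of_fixedPoint hD hφ hT hTe hw hfix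
  refine ⟨_, _, w, hsol, ?_, ?_⟩
  · intro X' v' w' hsol'
    have hww : w' = w := hV.fixedPoint_unique hD₀.le hδD.le hφ hγ hγg hsol'.feedback.continuous hw
      (hsol'.fixedPoint hD hφ hT hTe) hfix
    subst hww
    have hv : ∀ t, 0 ≤ t → v' t = delayedInput e D w' t := fun t ht => hsol'.input_eq hD ht
    refine ⟨rfl, fun t ht => ⟨?_, hv t ht⟩⟩
    exact (hsol'.mild.congr_input hv).eq t ht
  · intro t ht
    rw [norm_synthesis]
    refine (hdecay _ hV X₀ w _ hw hfix hwb hsol.mild t ht).trans ?_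
    gcongr
    linarith
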